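/- **Theorem (Tree Recognition).** Graphs are finite directed multigraphs (loops and parallel edges allowed) with node labels in $\{\square,\triangle\}$ and edge label $\square$, in which every node is either a root or unrooted; in the interface $K$ of a rule $L\leftarrow K\rightarrow R$ node labels and rootedness may be undefined. A rule is applied to $G$ at an injective morphism $g\colon L\to G$ (preserving sources, targets, labels and rootedness) such that no edge of $G$ outside $g(L)$ is incident to a node of $g(L\setminus K)$ (dangling condition): delete $g(L\setminus K)$, add $R\setminus K$ disjointly, and give the images of the nodes of $K$ with undefined label (rootedness) the label (rootedness) they have in $R$. Write $G\Rightarrow_{\mathcal R}M$ if $M$ is isomorphic to such a result for a rule in $\mathcal R$, and $G\Rightarrow^*_{\mathcal R}H$ if $G\cong H$ or $H$ arises from $G$ by finitely many such steps. $H$ is a normal form of $G$ if $G\Rightarrow_{\mathcal R}^*H$ and no rule applies to $H$. Let $\mathcal R=\{r_0,r_1,r_2\}$, where $\bullet$ marks a root and the interface nodes (those with an index) have undefined label and rootedness: $$r_0:\ (\square_1\to\square^\bullet)\ \leftarrow\ {\cdot}_1\ \rightarrow\ \square_1^\bullet,\qquad r_1:\ (\triangle_1\to\square^\bullet)\ \leftarrow\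 {\cdot}_1\ \rightarrow\ \square_1^\bullet,\qquad r_2:\ (\square_1^\bullet\to\square_2)\ \leftarrow\ {\cdot}_1\ {\cdot}_2\ \rightarrow\ (\triangle_1\to\square_2^\bullet).$$ An *input graph* is a graph with exactly one root all of whose nodes and edges are labelled $\square$; $G^\ominus$ is $G$ with all nodes unrooted and everything labelled $\square$. Let $L(\mathrm{TREE})$ be the set of isomorphism classes of graphs derivable from a single unrooted $\square$-node with the rule $\square_1\leftarrow\square_1\rightarrow(\square_1\to\square)$ (all nodes unrooted, the interface node labelled $\square$). A *tree* is a non-empty connected graph without undirected cycles (closed undirected walks of positive length repeating no edge) in which every node has at most one incoming edge. 1. Let $G$ be an input graph. Every derivation from $G$ with respect to $\mathcal R$ has length at most $2|V_G|$, $G$ has a normal form, and for every normal form $H$ of $G$ the following are equivalent: (a) $H$ is isomorphic to the graph with a single root node, labelled $\square$, and no edges; (b) $[G^\ominus]\in L(\mathrm{TREE})$; (c) $G^\ominus$ is a tree. 2. For input graphs of bounded degree a normal form is found in linear time: there is a program $P$ such that for every $b\in\mathbb N$ there is $c\in\mathbb N$ such that, started on any stored representation of an input graph $G$ with $\deg_G(v)=\operatorname{indeg}_G(v)+\operatorname{outdeg}_G(v)\le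 b$ for all nodes $v$, $P$ halts within time $c\,|V_G|$, and the graph then stored is a normal form of $G$ with respect to $\mathcal R$. Here a program is a while-program with finitely many registers for nodes, edges, and lists of nodes or edges, acting on one stored graph. Its operations and costs are: obtain the set $Z$ of rooted nodes with a given label (cost $|Z|+1$); the unrooted nodes with a given label (cost $|V|+1$); the set $X$ of edges with a given source, or with a given target (cost $|X|+1$); and, at cost $1$ each: compare an in- or outdegree, $|V|$ or $|E|$ with a constant, test a label, rootedness, equality of registers or emptiness of a list, pop a list, copy a register, go from an edge to its source or target, change the label or rootedness of a node, delete an edge, delete an isolated node. Sets are returned as lists in an order over which the program has no control. -/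

import Mathlib

namespace RootedGT

/-! ## Graphs and morphisms -/

/-- A finite directed multigraph over the label alphabet `(LV, LE)`. Node labels and rootedness are
partial functions (`none` is "undefined"); `p v = some true` says that `v` is a root node and
`p v = some false` that it is unrooted. -/
structure LGraph (LV LE : Type) where
  V : Type
  E : Type
  finV : Finite V
  finE : Finite E
  src : E → V
  tgt : E → V
  l : V → Option LV
  m : E → LE
  p : V → Option Bool

namespace LGraph

variable {LV LE : Type}

/-- Totally labelled, totally rooted graph. -/
def IsTLRG (G : LGraph LV LE) : Prop :=
  (∀ v, G.l v ≠ none) ∧ (∀ v, G.p v ≠ none)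

/-- Graph morphisms preserve sources, targets, edge labels, and node labels and rootedness wherever
these are defined in the domain. -/
structure Hom (G H : LGraph LV LE) where
  fV : G.V → H.V
  fE : G.E → H.E
  src_eq : ∀ e, fV (G.src e) = H.src (fE e)
  tgt_eq : ∀ e, fV (G.tgt e) = H.tgt (fE e)
  m_eq : ∀ e, G.m e = H.m (fE e)
  l_eq : ∀ v a, G.l v = some a → H.l (fV v) = some a
  p_eq : ∀ v a, G.p v = some a → H.p (fV v) = some a

/-- A morphism is injective iff both of its components are. -/
def Hom.Injective {G H : LGraph LV LE} (g : Hom G H) : Prop :=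
  Function.Injective g.fV ∧ Function.Injective g.fE

/-- `G ≅ H`: there are mutually inverse morphisms `G → H` and `H → G`. -/
def Isomorphic (G H : LGraph LV LE) : Prop :=
  ∃ (f : Hom G H) (g : Hom H G),
    (∀ v, g.fV (f.fV v) = v) ∧ (∀ v, f.fV (g.fV v) = v) ∧
    (∀ e, g.fE (f.fE e) = e) ∧ (∀ e, f.fE (g.fE e) = e)

/-- Identity morphism. -/
def Hom.id (G : LGraph LV LE) : Hom G G :=
  ⟨fun v => v, fun e => e, fun _ => rfl, fun _ => rfl, fun _ => rfl, fun _ _ h => h,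
    fun _ _ h => h⟩

/-- Composition of morphisms. -/
def Hom.comp {G H K : LGraph LV LE} (g : Hom H K) (f : Hom G H) : Hom G K where
  fV v := g.fV (f.fV v)
  fE e := g.fE (f.fE e)
  src_eq e := by rw [f.src_eq, g.src_eq]
  tgt_eq e := by rw [f.tgt_eq, g.tgt_eq]
  m_eq e := by rw [f.m_eq, g.m_eq]
  l_eq v a h := g.l_eq _ a (f.l_eq v a h)
  p_eq v a h := g.p_eq _ a (f.p_eq v a h)

theorem Isomorphic.refl (G : LGraph LV LE) : Isomorphic G G :=
  ⟨Hom.id G, Hom.id G, fun _ => rfl, fun _ => rfl, fun _ => rfl, fun _ => rfl⟩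

theorem Isomorphic.symm {G H : LGraph LV LE} : Isomorphic G H → Isomorphic H G :=
  fun ⟨f, g, h1, h2, h3, h4⟩ => ⟨g, f, h2, h1, h4, h3⟩

theorem Isomorphic.trans {G H K : LGraph LV LE} :
    Isomorphic G H → Isomorphic H K → Isomorphic G K := by
  rintro ⟨f, g, h1, h2, h3, h4⟩ ⟨f', g', h1', h2', h3', h4'⟩
  refine ⟨f'.comp f, g.comp g', ?_, ?_, ?_, ?_⟩ <;> intro x <;> simp [Hom.comp, *]

/-- Abstract graphs are isomorphism classes of graphs. -/
def isoSetoid (LV LE : Type) : Setoid (LGraph LV LE) :=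
  ⟨Isomorphic, Isomorphic.refl, Isomorphic.symm, Isomorphic.trans⟩

/-- The type of abstract graphs over `(LV, LE)`. -/
def Abstract (LV LE : Type) : Type 1 := Quotient (isoSetoid LV LE)

/-- The abstract graph `[G]`. -/
def cls (G : LGraph LV LE) : Abstract LV LE := Quotient.mk (isoSetoid LV LE) G

/-- `|V_G|`. -/
noncomputable def order (G : LGraph LV LE) : ℕ := Nat.card G.V

/-- Incoming degree. -/
noncomputable def indeg (G : LGraph LV LE) (v : G.V) : ℕ := Nat.card {e : G.E // G.tgt e = v}

/-- Outgoing degree. -/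
noncomputable def outdeg (G : LGraph LV LE) (v : G.V) : ℕ := Nat.card {e : G.E // G.src e = v}

/-- Degree; a loop counts twice. -/
noncomputable def deg (G : LGraph LV LE) (v : G.V) : ℕ := G.indeg v + G.outdeg v

/-- `UWalk G u v es`: there is an undirected walk from `u` to `v` with edge sequence `es`. -/
inductive UWalk (G : LGraph LV LE) : G.V → G.V → List G.E → Prop
  | nil (v : G.V) : UWalk G v v []
  | fwd (e : G.E) {w : G.V} {es : List G.E} :
      UWalk G (G.tgt e) w es → UWalk G (G.src e) w (e :: es)
  | bwd (e : G.E) {w : G.V} {es : List G.E} :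
      UWalk G (G.src e) w es → UWalk G (G.tgt e) w (e :: es)

/-- A tree is a non-empty connected graph without undirected cycles (closed undirected walks of
positive length that repeat no edge) in which every node has at most one incoming edge. -/
def IsTree (G : LGraph LV LE) : Prop :=
  Nonempty G.V ∧ (∀ u v, ∃ es, UWalk G u v es) ∧
    (∀ v es, UWalk G v v es → es.Nodup → es = []) ∧ (∀ v, G.indeg v ≤ 1)

end LGraph

/-! ## Rules and derivations -/

/-- A rule `L ← K → R` with `L`, `R` totally labelled and totally rooted. The inclusions of the
interface `K` are given as injective morphisms. -/
structure Rule (LV LE : Type) where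
  L : LGraph LV LE
  K : LGraph LV LE
  R : LGraph LV LE
  tlrgL : L.IsTLRG
  tlrgR : R.IsTLRG
  left : LGraph.Hom K L
  right : LGraph.Hom K R
  left_inj : left.Injective
  right_inj : right.Injective

/-- A match of a rule in `G`: an injective morphism `g : L → G` satisfying the dangling condition,
that is, no edge of `G` outside `g(L)` is incident to a node of `g(L \ K)`. -/
structure Match {LV LE : Type} (r : Rule LV LE) (G : LGraph LV LE) where
  g : LGraph.Hom r.L G
  inj : g.Injective
  dangling : ∀ e : G.E, (∀ y, g.fE y ≠ e) → ∀ x : r.L.V, (∀ k, r.left.fV k ≠ x) →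
    G.src e ≠ g.fV x ∧ G.tgt e ≠ g.fV x

namespace Match

variable {LV LE : Type} {r : Rule LV LE} {G : LGraph LV LE}

/-- The node `v` of `G` lies in `g(L \ K)`. -/
def DelV (μ : Match r G) (v : G.V) : Prop :=
  ∃ x : r.L.V, (∀ k, r.left.fV k ≠ x) ∧ μ.g.fV x = v

/-- The edge `e` of `G` lies in `g(L \ K)`. -/
def DelE (μ : Match r G) (e : G.E) : Prop :=
  ∃ y : r.L.E, (∀ k, r.left.fE k ≠ y) ∧ μ.g.fE y = e

theorem src_not_del (μ : Match r G) {e : G.E} (he : ¬ μ.DelE e) : ¬ μ.DelV (G.src e) := by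
  rintro ⟨x, hx, hxe⟩
  by_cases h : ∀ y, μ.g.fE y ≠ e
  · exact (μ.dangling e h x hx).1 hxe.symm
  · push Not at h
    obtain ⟨y, rfl⟩ := h
    by_cases hk : ∀ k, r.left.fE k ≠ y
    · exact he ⟨y, hk, rfl⟩
    · push Not at hk
      obtain ⟨k, rfl⟩ := hk
      rw [← μ.g.src_eq, ← r.left.src_eq] at hxe
      exact hx _ (μ.inj.1 hxe).symm

theorem tgt_not_del (μ : Match r G) {e : G.E} (he : ¬ μ.DelE e) : ¬ μ.DelV (G.tgt e) := by
  rintro ⟨x, hx, hxe⟩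
  by_cases h : ∀ y, μ.g.fE y ≠ e
  · exact (μ.dangling e h x hx).2 hxe.symm
  · push Not at h
    obtain ⟨y, rfl⟩ := h
    by_cases hk : ∀ k, r.left.fE k ≠ y
    · exact he ⟨y, hk, rfl⟩
    · push Not at hk
      obtain ⟨k, rfl⟩ := hk
      rw [← μ.g.tgt_eq, ← r.left.tgt_eq] at hxe
      exact hx _ (μ.inj.1 hxe).symm

theorem image_not_del (μ : Match r G) (k : r.K.V) : ¬ μ.DelV (μ.g.fV (r.left.fV k)) := by
  rintro ⟨x, hx, hxe⟩
  exact hx k (μ.inj.1 hxe).symm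

/-- Nodes of the intermediate graph: those of `G` outside `g(L \ K)`. -/
abbrev InterV (μ : Match r G) : Type := {v : G.V // ¬ μ.DelV v}

/-- Edges of the intermediate graph: those of `G` outside `g(L \ K)`. -/
abbrev InterE (μ : Match r G) : Type := {e : G.E // ¬ μ.DelE e}

open Classical in
/-- The intermediate graph `D`: delete `g(L \ K)`, and make the images of those interface nodes
whose label (rootedness) is undefined in `K` unlabelled (of undefined rootedness). -/
noncomputable def inter (μ : Match r G) : LGraph LV LE where
  V := μ.InterV
  E := μ.InterE
  finV := by have := G.finV; infer_instance
  finE := by have := G.finE; infer_instance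
  src e := ⟨G.src e.1, μ.src_not_del e.2⟩
  tgt e := ⟨G.tgt e.1, μ.tgt_not_del e.2⟩
  l v := if ∃ k, r.K.l k = none ∧ μ.g.fV (r.left.fV k) = v.1 then none else G.l v.1
  m e := G.m e.1
  p v := if ∃ k, r.K.p k = none ∧ μ.g.fV (r.left.fV k) = v.1 then none else G.p v.1

/-- Nodes of the result graph: those of `D` and, disjointly, those of `R \ K`. -/
abbrev ResV (μ : Match r G) : Type :=
  μ.InterV ⊕ {x : r.R.V // ∀ k, r.right.fV k ≠ x}

open Classical in
/-- The node of the result graph that a node of `R` becomes (the comatch). -/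
noncomputable def place (μ : Match r G) (x : r.R.V) : μ.ResV :=
  if h : ∃ k, r.right.fV k = x then
    Sum.inl ⟨μ.g.fV (r.left.fV h.choose), μ.image_not_del h.choose⟩
  else Sum.inr ⟨x, fun k hk => h ⟨k, hk⟩⟩

open Classical in
/-- The result graph `H`: add `R \ K` disjointly to `D`, and give the images of those interface
nodes whose label (rootedness) is undefined in `K` the label (rootedness) that they have in `R`. -/
noncomputable def result (μ : Match r G) : LGraph LV LE where
  V := μ.ResV
  E := μ.InterE ⊕ {y : r.R.E // ∀ k, r.right.fE k ≠ y}
  finV := by have := G.finV; have := r.R.finV; infer_instance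
  finE := by have := G.finE; have := r.R.finE; infer_instance
  src := Sum.elim (fun e : μ.InterE => Sum.inl (μ.inter.src e)) (fun y => μ.place (r.R.src y.1))
  tgt := Sum.elim (fun e : μ.InterE => Sum.inl (μ.inter.tgt e)) (fun y => μ.place (r.R.tgt y.1))
  l := Sum.elim
    (fun v : μ.InterV => if h : ∃ k, r.K.l k = none ∧ μ.g.fV (r.left.fV k) = v.1
      then r.R.l (r.right.fV h.choose) else μ.inter.l v)
    (fun x => r.R.l x.1)
  m := Sum.elim (fun e : μ.InterE => μ.inter.m e) (fun y => r.R.m y.1)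
  p := Sum.elim
    (fun v : μ.InterV => if h : ∃ k, r.K.p k = none ∧ μ.g.fV (r.left.fV k) = v.1
      then r.R.p (r.right.fV h.choose) else μ.inter.p v)
    (fun x => r.R.p x.1)

end Match

section Systems

variable {LV LE : Type}

/-- Direct derivation `G ⇒_R M`: some rule of `R` applied to `G` at some match has a result
isomorphic to `M`. -/
def DirectDerivation (R : Set (Rule LV LE)) (G M : LGraph LV LE) : Prop :=
  ∃ r ∈ R, ∃ μ : Match r G, LGraph.Isomorphic M μ.result

/-- `H` is derived from `G` by a derivation of length `n`. -/
def DerivesIn (R : Set (Rule LV LE)) : ℕ → LGraph LV LE → LGraph LV LE → Prop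
  | 0, G, H => LGraph.Isomorphic G H
  | n + 1, G, H => ∃ M, DerivesIn R n G M ∧ DirectDerivation R M H

/-- `G ⇒_R^* H`. -/
def Derives (R : Set (Rule LV LE)) (G H : LGraph LV LE) : Prop := ∃ n, DerivesIn R n G H

/-- `H` is in normal form iff no rule applies to it. -/
def InNormalForm (R : Set (Rule LV LE)) (H : LGraph LV LE) : Prop :=
  ¬ ∃ M, DirectDerivation R H M

/-- `H` is a normal form of `G`. -/
def IsNormalFormOf (R : Set (Rule LV LE)) (H G : LGraph LV LE) : Prop :=
  Derives R G H ∧ InNormalForm R H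

/-- A graph grammar: a finite set of rules, non-terminal labels, and a start graph. -/
structure Grammar (LV LE : Type) where
  nonterminalV : Set LV
  nonterminalE : Set LE
  rules : Set (Rule LV LE)
  rules_finite : rules.Finite
  start : LGraph LV LE

/-- The language of a grammar: the abstract graphs `[G]` with `S ⇒^* G` and `G` terminally
labelled. -/
def Grammar.language (Γ : Grammar LV LE) : Set (LGraph.Abstract LV LE) :=
  {A | ∃ G : LGraph LV LE, A = G.cls ∧ Derives Γ.rules Γ.start G ∧
    (∀ v a, G.l v = some a → a ∉ Γ.nonterminalV) ∧ (∀ e, G.m e ∉ Γ.nonterminalE)}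

/-- The discrete graph with nodes `0, …, n - 1`, all with label `a` and rootedness `b`. -/
def discrete (n : ℕ) (a : Option LV) (b : Option Bool) : LGraph LV LE where
  V := Fin n
  E := Empty
  finV := inferInstance
  finE := inferInstance
  src := Empty.elim
  tgt := Empty.elim
  l _ := a
  m := Empty.elim
  p _ := b

/-- The graph with nodes `0`, `1` and a single edge, labelled `c`, from `0` to `1`; node `i` has
label `a i` and rootedness `b i`. -/
def arrow (c : LE) (a : Fin 2 → LV) (b : Fin 2 → Bool) : LGraph LV LE where
  V := Fin 2
  E := Unit
  finV := inferInstance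
  finE := inferInstance
  src _ := 0
  tgt _ := 1
  l i := some (a i)
  m _ := c
  p i := some (b i)

end Systems

/-! ## The alphabets, the tree grammar and the tree recognition system -/

/-- The one-element label alphabet `{□}`. -/
inductive Box
  | box
deriving DecidableEq

/-- The node label alphabet `{□, △}`. -/
inductive Mark
  | box
  | tri
deriving DecidableEq

/-- The rule of the tree grammar: `□₁ ← □₁ → (□₁ → □)`, all nodes unrooted. -/
def treeRule : Rule Box Box where
  L := discrete 1 (some .box) (some false)
  K := discrete 1 (some .box) (some false)
  R := arrow .box ![.box, .box] ![false, false]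
  tlrgL := by simp [LGraph.IsTLRG, discrete]
  tlrgR := by simp [LGraph.IsTLRG, arrow]
  left := LGraph.Hom.id _
  right :=
    { fV := fun _ => (0 : Fin 2)
      fE := Empty.elim
      src_eq := by rintro ⟨⟩
      tgt_eq := by rintro ⟨⟩
      m_eq := by rintro ⟨⟩
      l_eq := by simp [discrete, arrow]
      p_eq := by simp [discrete, arrow] }
  left_inj := ⟨fun _ _ h => h, fun _ _ h => h⟩
  right_inj := ⟨fun x y _ => Subsingleton.elim (α := Fin 1) x y, fun x => x.elim⟩

/-- The grammar `TREE`: start from a single node labelled `□`; no non-terminals. -/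
def TREE : Grammar Box Box where
  nonterminalV := ∅
  nonterminalE := ∅
  rules := {treeRule}
  rules_finite := Set.finite_singleton _
  start := discrete 1 (some .box) (some false)

/-- Pruning rule: an unrooted node `1` with label `a` and an edge to a root labelled `□`, which is
deleted together with the edge, while node `1` becomes a root labelled `□`. -/
def pruneRule (a : Mark) : Rule Mark Box where
  L := arrow .box ![a, .box] ![false, true]
  K := discrete 1 none none
  R := discrete 1 (some .box) (some true)
  tlrgL := by simp [LGraph.IsTLRG, arrow]
  tlrgR := by simp [LGraph.IsTLRG, discrete]
  left :=
    { fV := fun _ => (0 : Fin 2)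
      fE := Empty.elim
      src_eq := by rintro ⟨⟩
      tgt_eq := by rintro ⟨⟩
      m_eq := by rintro ⟨⟩
      l_eq := by simp [discrete]
      p_eq := by simp [discrete] }
  right :=
    { fV := fun v => v
      fE := fun e => e
      src_eq := by rintro ⟨⟩
      tgt_eq := by rintro ⟨⟩
      m_eq := by rintro ⟨⟩
      l_eq := by simp [discrete]
      p_eq := by simp [discrete] }
  left_inj := ⟨fun x y _ => Subsingleton.elim (α := Fin 1) x y, fun x => x.elim⟩
  right_inj := ⟨fun _ _ h => h, fun _ _ h => h⟩

/-- The rule `r₀`: `(□₁ → ⟦□⟧) ← ₁ → ⟦□⟧₁`, where `⟦ ⟧` marks roots. -/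
def r0 : Rule Mark Box := pruneRule .box

/-- The rule `r₁`: `(△₁ → ⟦□⟧) ← ₁ → ⟦□⟧₁`, where `⟦ ⟧` marks roots. -/
def r1 : Rule Mark Box := pruneRule .tri

/-- The rule `r₂`: `(⟦□⟧₁ → □₂) ← ₁ ₂ → (△₁ → ⟦□⟧₂)`, where `⟦ ⟧` marks roots. -/
def r2 : Rule Mark Box where
  L := arrow .box ![.box, .box] ![true, false]
  K := discrete 2 none none
  R := arrow .box ![.tri, .box] ![false, true]
  tlrgL := by simp [LGraph.IsTLRG, arrow]
  tlrgR := by simp [LGraph.IsTLRG, arrow]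
  left :=
    { fV := fun v => v
      fE := Empty.elim
      src_eq := by rintro ⟨⟩
      tgt_eq := by rintro ⟨⟩
      m_eq := by rintro ⟨⟩
      l_eq := by simp [discrete]
      p_eq := by simp [discrete] }
  right :=
    { fV := fun v => v
      fE := Empty.elim
      src_eq := by rintro ⟨⟩
      tgt_eq := by rintro ⟨⟩
      m_eq := by rintro ⟨⟩
      l_eq := by simp [discrete]
      p_eq := by simp [discrete] }
  left_inj := ⟨fun _ _ h => h, fun x => x.elim⟩
  right_inj := ⟨fun _ _ h => h, fun x => x.elim⟩

/-- The rules of the tree recognition system. -/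
def treeRules : Set (Rule Mark Box) := {r0, r1, r2}

/-- An input graph: a TLRG with exactly one root node whose nodes and edges are all labelled `□`
(`□` is the only edge label there is). -/
def IsInputGraph (G : LGraph Mark Box) : Prop :=
  G.IsTLRG ∧ (∃! v, G.p v = some true) ∧ (∀ v, G.l v = some .box) ∧ (∀ e, G.m e = .box)

/-- `G^⊖`: the graph `G` with every node unrooted and everything labelled by `□`. -/
def unlabel {LV LE : Type} (G : LGraph LV LE) : LGraph Box Box where
  V := G.V
  E := G.E
  finV := G.finV
  finE := G.finE
  src := G.src
  tgt := G.tgt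
  l _ := some .box
  m _ := .box
  p _ := some false

/-- The single root-node graph labelled by `□`. -/
def singleRoot : LGraph Mark Box := discrete 1 (some .box) (some true)

/-! ## Graph programs and their running time

Programs of a small imperative language manipulate one stored graph through finitely many
registers, which hold node and edge addresses and lists of them. The rooted (unrooted) nodes with a
given label are returned in time `O(|Z|)` (`O(|V|)`), the edges with a given source or target in
time `O(|X|)`, where `Z` and `X` are the sets returned; all other operations take unit time. -/

/-- A stored TLRG. Nodes and edges are addressed by natural numbers; `src`, `lab`, … are
meaningful only on the addresses in `V` and `E`. -/
structure Store (LV LE : Type) where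
  V : Finset ℕ
  E : Finset ℕ
  src : ℕ → ℕ
  tgt : ℕ → ℕ
  src_mem : ∀ e ∈ E, src e ∈ V
  tgt_mem : ∀ e ∈ E, tgt e ∈ V
  lab : ℕ → LV
  mark : ℕ → LE
  root : ℕ → Bool

namespace Store

variable {LV LE : Type}

/-- The graph that is stored. -/
def toGraph (S : Store LV LE) : LGraph LV LE where
  V := {v : ℕ // v ∈ S.V}
  E := {e : ℕ // e ∈ S.E}
  finV := inferInstance
  finE := inferInstance
  src e := ⟨S.src e.1, S.src_mem e.1 e.2⟩
  tgt e := ⟨S.tgt e.1, S.tgt_mem e.1 e.2⟩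
  l v := some (S.lab v.1)
  m e := S.mark e.1
  p v := some (S.root v.1)

/-- Addresses of the edges with source `v`. -/
def outSet (S : Store LV LE) (v : ℕ) : Finset ℕ := S.E.filter fun e => S.src e = v

/-- Addresses of the edges with target `v`. -/
def inSet (S : Store LV LE) (v : ℕ) : Finset ℕ := S.E.filter fun e => S.tgt e = v

/-- Addresses of the nodes with label `a` and rootedness `b`. -/
def nodeSet [DecidableEq LV] (S : Store LV LE) (a : LV) (b : Bool) : Finset ℕ :=
  S.V.filter fun v => S.lab v = a ∧ S.root v = b

/-- Delete an edge. -/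
def delEdge (S : Store LV LE) (e : ℕ) : Store LV LE :=
  { S with
    E := S.E.erase e
    src_mem := fun x hx => S.src_mem x (Finset.mem_of_mem_erase hx)
    tgt_mem := fun x hx => S.tgt_mem x (Finset.mem_of_mem_erase hx) }

/-- Delete an isolated node; undefined on nodes with incident edges. -/
def delNode (S : Store LV LE) (v : ℕ) : Option (Store LV LE) :=
  if h : ∀ e ∈ S.E, S.src e ≠ v ∧ S.tgt e ≠ v then
    some { S with
      V := S.V.erase v
      src_mem := fun e he => Finset.mem_erase.2 ⟨(h e he).1, S.src_mem e he⟩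
      tgt_mem := fun e he => Finset.mem_erase.2 ⟨(h e he).2, S.tgt_mem e he⟩ }
  else none

/-- Relabel a node. -/
def setLab (S : Store LV LE) (v : ℕ) (a : LV) : Store LV LE :=
  { S with lab := Function.update S.lab v a }

/-- Change the rootedness of a node. -/
def setRoot (S : Store LV LE) (v : ℕ) (b : Bool) : Store LV LE :=
  { S with root := Function.update S.root v b }

end Store

/-- Machine states: the stored graph, the registers, and the time elapsed. -/
structure State (LV LE : Type) where
  store : Store LV LE
  nreg : ℕ → ℕ
  ereg : ℕ → ℕ
  nlist : ℕ → List ℕ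
  elist : ℕ → List ℕ
  time : ℕ

/-- Tests, all of unit cost. Arguments `i`, `j` name registers. -/
inductive Test (LV LE : Type)
  | nodeLab (i : ℕ) (a : LV)
  | edgeLab (i : ℕ) (c : LE)
  | rooted (i : ℕ)
  | nodeEq (i j : ℕ)
  | edgeEq (i j : ℕ)
  | indegEq (i k : ℕ)
  | outdegEq (i k : ℕ)
  | numNodesEq (k : ℕ)
  | numEdgesEq (k : ℕ)
  | nlistEmpty (j : ℕ)
  | elistEmpty (j : ℕ)

/-- Value of a test. -/
def Test.eval {LV LE : Type} [DecidableEq LV] [DecidableEq LE] (s : State LV LE) :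
    Test LV LE → Bool
  | .nodeLab i a => decide (s.store.lab (s.nreg i) = a)
  | .edgeLab i c => decide (s.store.mark (s.ereg i) = c)
  | .rooted i => s.store.root (s.nreg i)
  | .nodeEq i j => decide (s.nreg i = s.nreg j)
  | .edgeEq i j => decide (s.ereg i = s.ereg j)
  | .indegEq i k => decide ((s.store.inSet (s.nreg i)).card = k)
  | .outdegEq i k => decide ((s.store.outSet (s.nreg i)).card = k)
  | .numNodesEq k => decide (s.store.V.card = k)
  | .numEdgesEq k => decide (s.store.E.card = k)
  | .nlistEmpty j => (s.nlist j).isEmpty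
  | .elistEmpty j => (s.elist j).isEmpty

/-- Elementary operations. Arguments `i`, `j` name registers. -/
inductive Op (LV : Type)
  | rootedNodes (a : LV) (j : ℕ)
  | unrootedNodes (a : LV) (j : ℕ)
  | outEdges (i j : ℕ)
  | inEdges (i j : ℕ)
  | popNode (j i : ℕ)
  | popEdge (j i : ℕ)
  | copyNode (i j : ℕ)
  | copyEdge (i j : ℕ)
  | srcOf (i j : ℕ)
  | tgtOf (i j : ℕ)
  | setLab (i : ℕ) (a : LV)
  | setRoot (i : ℕ) (b : Bool)
  | delEdge (i : ℕ)
  | delNode (i : ℕ)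

/-- A queried set is returned as a list in an order over which the program has no control; it may
depend on the time of the query. -/
structure Enumeration where
  list : ℕ → Finset ℕ → List ℕ
  nodup : ∀ t X, (list t X).Nodup
  mem_iff : ∀ t X x, x ∈ list t X ↔ x ∈ X

/-- Effect of an operation, including its cost; `none` means that the operation is undefined
(popping from an empty list, deleting a node with incident edges). -/
def Op.eval {LV LE : Type} [DecidableEq LV] (ord : Enumeration) (s : State LV LE) :
    Op LV → Option (State LV LE)
  | .rootedNodes a j =>
      let Z := s.store.nodeSet a true
      some { s with
        nlist := Function.update s.nlist j (ord.list s.time Z)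
        time := s.time + (Z.card + 1) }
  | .unrootedNodes a j =>
      let Z := s.store.nodeSet a false
      some { s with
        nlist := Function.update s.nlist j (ord.list s.time Z)
        time := s.time + (s.store.V.card + 1) }
  | .outEdges i j =>
      let X := s.store.outSet (s.nreg i)
      some { s with
        elist := Function.update s.elist j (ord.list s.time X)
        time := s.time + (X.card + 1) }
  | .inEdges i j =>
      let X := s.store.inSet (s.nreg i)
      some { s with
        elist := Function.update s.elist j (ord.list s.time X)
        time := s.time + (X.card + 1) }
  | .popNode j i =>
      match s.nlist j with
      | [] => none
      | x :: xs => some { s with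
          nreg := Function.update s.nreg i x
          nlist := Function.update s.nlist j xs
          time := s.time + 1 }
  | .popEdge j i =>
      match s.elist j with
      | [] => none
      | x :: xs => some { s with
          ereg := Function.update s.ereg i x
          elist := Function.update s.elist j xs
          time := s.time + 1 }
  | .copyNode i j =>
      some { s with nreg := Function.update s.nreg j (s.nreg i), time := s.time + 1 }
  | .copyEdge i j =>
      some { s with ereg := Function.update s.ereg j (s.ereg i), time := s.time + 1 }
  | .srcOf i j =>
      some { s with
        nreg := Function.update s.nreg j (s.store.src (s.ereg i))
        time := s.time + 1 }
  | .tgtOf i j =>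
      some { s with
        nreg := Function.update s.nreg j (s.store.tgt (s.ereg i))
        time := s.time + 1 }
  | .setLab i a =>
      some { s with store := s.store.setLab (s.nreg i) a, time := s.time + 1 }
  | .setRoot i b =>
      some { s with store := s.store.setRoot (s.nreg i) b, time := s.time + 1 }
  | .delEdge i =>
      some { s with store := s.store.delEdge (s.ereg i), time := s.time + 1 }
  | .delNode i =>
      (s.store.delNode (s.nreg i)).map fun S => { s with store := S, time := s.time + 1 }

/-- Programs. -/
inductive Prog (LV LE : Type)
  | skip
  | op (o : Op LV)
  | seq (P Q : Prog LV LE)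
  | ite (t : Test LV LE) (P Q : Prog LV LE)
  | while (t : Test LV LE) (P : Prog LV LE)

/-- The state after spending one unit of time on a test. -/
def State.tick {LV LE : Type} (s : State LV LE) : State LV LE := { s with time := s.time + 1 }

/-- `Exec ord P s s'`: started in `s`, the program `P` halts in the state `s'`. Execution is
deterministic once the enumeration `ord` is fixed. -/
inductive Exec {LV LE : Type} [DecidableEq LV] [DecidableEq LE] (ord : Enumeration) :
    Prog LV LE → State LV LE → State LV LE → Prop
  | skip {s} : Exec ord .skip s s
  | op {o s s'} : Op.eval ord s o = some s' → Exec ord (.op o) s s'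
  | seq {P Q s s' s''} : Exec ord P s s' → Exec ord Q s' s'' → Exec ord (.seq P Q) s s''
  | iteTrue {t P Q s s'} : Test.eval s t = true → Exec ord P s.tick s' →
      Exec ord (.ite t P Q) s s'
  | iteFalse {t P Q s s'} : Test.eval s t = false → Exec ord Q s.tick s' →
      Exec ord (.ite t P Q) s s'
  | whileFalse {t P s} : Test.eval s t = false → Exec ord (.while t P) s s.tick
  | whileTrue {t P s s' s''} : Test.eval s t = true → Exec ord P s.tick s' →
      Exec ord (.while t P) s' s'' → Exec ord (.while t P) s s''

end RootedGT

open RootedGT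

namespace RootedGT

open Function LGraph

/-! The system is a depth-first traversal by its root. The rule `r2` moves the root down along an
edge and leaves `△` behind; `r0` and `r1` delete a root whose only incident edge is incoming and
move the root back to its parent.

Termination: the number of nodes plus the number of `□`-nodes drops in every step
(`DirectDerivation.weight_lt`) and equals `2 * G.order` on an input graph. This bounds all
derivations and yields a normal form.

Correctness: on underlying graphs, `r2` changes nothing and pruning removes a leaf. Read backwards,
a derivation ending in the single root is therefore a derivation of `TREE`, so (a) gives (b). Since
the grammar only adds leaves and `LeafExt.isTree` preserves trees, (b) gives (c). For (c) to (a),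
removing leaves also preserves trees, so every normal form `H` of a tree is a tree. By the invariant
`WellRooted` it has exactly one root, and every `△`-node has a directed path to it. If the root of
`H` had an outgoing edge, its target would be `□`, and `r2` would apply, or `△`, and there would be
a directed cycle. An incoming edge would then be the only edge at the root, and could be pruned. So
the root is isolated, and by connectedness it is all of `H` (`WellRooted.isomorphic_singleRoot`).

Running time: the program keeps the list of those outgoing edges of the root that are not yet
inspected and rebuilds it after every rule application, at a cost bounded by the degree. A linear
combination of the weight and the list length pays for each pass of the loop (`LoopInv.exec_body`).
When the list is empty, `r2` is not applicable, and two degree tests decide whether pruning is. -/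

instance : Subsingleton Box := ⟨by rintro ⟨⟩ ⟨⟩; rfl⟩

namespace LGraph

variable {LV LE LV' LE' : Type}

/-! ## Isomorphisms as pairs of equivalences -/

/-- A morphism may define labels that are undefined in its domain, but a morphism in the opposite
direction excludes this. Hence partial labels agree exactly. -/
theorem isomorphic_iff {G H : LGraph LV LE} : Isomorphic G H ↔
    ∃ (fV : G.V ≃ H.V) (fE : G.E ≃ H.E),
      (∀ e, fV (G.src e) = H.src (fE e)) ∧ (∀ e, fV (G.tgt e) = H.tgt (fE e)) ∧
      (∀ e, G.m e = H.m (fE e)) ∧ (∀ v, G.l v = H.l (fV v)) ∧ ∀ v, G.p v = H.p (fV v) := by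
  constructor
  · rintro ⟨f, g, h1, h2, h3, h4⟩
    refine ⟨⟨f.fV, g.fV, h1, h2⟩, ⟨f.fE, g.fE, h3, h4⟩, f.src_eq, f.tgt_eq, f.m_eq, ?_, ?_⟩
    · intro v
      refine Option.ext fun a => ⟨f.l_eq v a, fun h => ?_⟩
      have := g.l_eq _ a h
      rwa [Equiv.coe_fn_mk, h1] at this
    · intro v
      refine Option.ext fun a => ⟨f.p_eq v a, fun h => ?_⟩
      have := g.p_eq _ a h
      rwa [Equiv.coe_fn_mk, h1] at this
  · rintro ⟨fV, fE, hs, ht, hm, hl, hp⟩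
    refine ⟨⟨fV, fE, hs, ht, hm, fun v a h => (hl v).symm.trans h,
      fun v a h => (hp v).symm.trans h⟩,
      ⟨fV.symm, fE.symm, fun e => ?_, fun e => ?_, fun e => ?_, fun v a h => ?_,
        fun v a h => ?_⟩, by simp, by simp, by simp, by simp⟩
    · rw [Equiv.symm_apply_eq, hs, Equiv.apply_symm_apply]
    · rw [Equiv.symm_apply_eq, ht, Equiv.apply_symm_apply]
    · rw [hm, Equiv.apply_symm_apply]
    · rw [hl, Equiv.apply_symm_apply, h]
    · rw [hp, Equiv.apply_symm_apply, h]

/-! ## Walks -/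

theorem UWalk.map {G : LGraph LV LE} {H : LGraph LV' LE'} {fV : G.V → H.V} {fE : G.E → H.E}
    (hs : ∀ e, fV (G.src e) = H.src (fE e)) (ht : ∀ e, fV (G.tgt e) = H.tgt (fE e))
    {a b : G.V} {es : List G.E} (h : UWalk G a b es) : UWalk H (fV a) (fV b) (es.map fE) := by
  induction h with
  | nil v => exact .nil _
  | fwd e _ ih => rw [hs]; rw [ht] at ih; exact .fwd _ ih
  | bwd e _ ih => rw [ht]; rw [hs] at ih; exact .bwd _ ih

theorem UWalk.append {G : LGraph LV LE} {a b c : G.V} {es fs : List G.E}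
    (h : UWalk G a b es) (h' : UWalk G b c fs) : UWalk G a c (es ++ fs) := by
  induction h with
  | nil v => exact h'
  | fwd e _ ih => exact .fwd _ (ih h')
  | bwd e _ ih => exact .bwd _ (ih h')

theorem indeg_le_one_iff {G : LGraph LV LE} {v : G.V} :
    G.indeg v ≤ 1 ↔ ∀ e e', G.tgt e = v → G.tgt e' = v → e = e' := by
  have := G.finE
  rw [indeg, Finite.card_le_one_iff_subsingleton]
  exact ⟨fun h e e' he he' => congrArg Subtype.val (h.elim ⟨e, he⟩ ⟨e', he'⟩),
    fun h => ⟨fun e e' => Subtype.ext (h _ _ e.2 e'.2)⟩⟩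

/-- Being a tree depends only on sources and targets. -/
theorem IsTree.of_equiv {G : LGraph LV LE} {H : LGraph LV' LE'} (fV : G.V ≃ H.V)
    (fE : G.E ≃ H.E) (hs : ∀ e, fV (G.src e) = H.src (fE e))
    (ht : ∀ e, fV (G.tgt e) = H.tgt (fE e)) (h : G.IsTree) : H.IsTree := by
  obtain ⟨⟨v⟩, hc, ha, hd⟩ := h
  have hs' : ∀ e, fV.symm (H.src e) = G.src (fE.symm e) := fun e => by
    rw [Equiv.symm_apply_eq, hs, Equiv.apply_symm_apply]
  have ht' : ∀ e, fV.symm (H.tgt e) = G.tgt (fE.symm e) := fun e => by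
    rw [Equiv.symm_apply_eq, ht, Equiv.apply_symm_apply]
  refine ⟨⟨fV v⟩, fun x y => ?_, fun x es hw hn => ?_, fun x => ?_⟩
  · obtain ⟨es, hes⟩ := hc (fV.symm x) (fV.symm y)
    have := hes.map hs ht
    rw [Equiv.apply_symm_apply, Equiv.apply_symm_apply] at this
    exact ⟨_, this⟩
  · have := ha _ _ (hw.map hs' ht') (hn.map fE.symm.injective)
    simpa using this
  · rw [indeg_le_one_iff]
    intro e e' he he'
    have := indeg_le_one_iff.1 (hd (fV.symm x)) (fE.symm e) (fE.symm e')
      (by rw [← ht', he]) (by rw [← ht', he'])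
    exact fE.symm.injective this

/-! ### Directed walks and directed cycles -/

/-- There is an edge from `a` to `b`. -/
def Arc (G : LGraph LV LE) (a b : G.V) : Prop := ∃ e, G.src e = a ∧ G.tgt e = b

/-- Directed walks with their edge sequence. -/
inductive DWalk (G : LGraph LV LE) : G.V → G.V → List G.E → Prop
  | nil (v : G.V) : DWalk G v v []
  | cons (e : G.E) {w : G.V} {es : List G.E} :
      DWalk G (G.tgt e) w es → DWalk G (G.src e) w (e :: es)

theorem DWalk.toUWalk {G : LGraph LV LE} {a b : G.V} {es : List G.E} (h : DWalk G a b es) :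
    UWalk G a b es := by
  induction h with
  | nil v => exact .nil _
  | cons e _ ih => exact .fwd _ ih

/-- Cutting a walk off just before an occurrence of `e` leaves a suffix, so absence of repetitions
is inherited. -/
theorem DWalk.from_edge {G : LGraph LV LE} {a b : G.V} {es : List G.E} (h : DWalk G a b es)
    {e : G.E} (he : e ∈ es) : ∃ t, DWalk G (G.src e) b (e :: t) ∧ (e :: t).Sublist es := by
  induction h with
  | nil v => simp at he
  | cons e' h ih =>
    rcases List.mem_cons.1 he with rfl | he
    · exact ⟨_, .cons _ h, List.Sublist.refl _⟩
    · obtain ⟨t, ht, hs⟩ := ih he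
      exact ⟨t, ht, hs.cons _⟩

/-- If the edge to be prepended already occurs, the part of the walk from that occurrence on starts
at the same node and replaces the whole. -/
theorem exists_nodup_dwalk {G : LGraph LV LE} {a b : G.V} (h : Relation.ReflTransGen G.Arc a b) :
    ∃ es, DWalk G a b es ∧ es.Nodup := by
  induction h using Relation.ReflTransGen.head_induction_on with
  | refl => exact ⟨[], .nil _, List.nodup_nil⟩
  | head h _ ih =>
    obtain ⟨e, rfl, rfl⟩ := h
    obtain ⟨es, hw, hn⟩ := ih
    by_cases he : e ∈ es
    · obtain ⟨t, ht, hs⟩ := hw.from_edge he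
      exact ⟨_, ht, hn.sublist hs⟩
    · exact ⟨_, .cons e hw, List.nodup_cons.2 ⟨he, hn⟩⟩

/-- A tree has no directed cycles. -/
theorem IsTree.not_reach_src {G : LGraph LV LE} (hG : G.IsTree) (e : G.E)
    (h : Relation.ReflTransGen G.Arc (G.tgt e) (G.src e)) : False := by
  obtain ⟨es, hw, hn⟩ := exists_nodup_dwalk h
  -- The walk leads to the source of `e`. It becomes a closed walk without repeated edges by
  -- starting at `e` if it contains `e`, and by prepending `e` otherwise.
  by_cases he : e ∈ es
  · obtain ⟨t, ht, hs⟩ := hw.from_edge he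
    exact List.cons_ne_nil _ _ (hG.2.2.1 _ _ ht.toUWalk (hn.sublist hs))
  · exact List.cons_ne_nil _ _
      (hG.2.2.1 _ _ (DWalk.cons e hw).toUWalk (List.nodup_cons.2 ⟨he, hn⟩))

/-! ## Adding a leaf -/

/-- `Y` arises from `X` by adding a new node, the target of the new edge `leafE`, whose source is
the image of the node `at` of `X`. -/
structure LeafExt (X : LGraph LV LE) (Y : LGraph LV' LE') where
  fV : X.V → Y.V
  fE : X.E → Y.E
  injV : Injective fV
  injE : Injective fE
  src_eq : ∀ e, fV (X.src e) = Y.src (fE e)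
  tgt_eq : ∀ e, fV (X.tgt e) = Y.tgt (fE e)
  leafE : Y.E
  stem : X.V
  src_leaf : Y.src leafE = fV stem
  tgt_leaf : ∀ x, fV x ≠ Y.tgt leafE
  leafE_new : ∀ x, fE x ≠ leafE
  surjV : ∀ v, v ≠ Y.tgt leafE → ∃ x, fV x = v
  surjE : ∀ e, e ≠ leafE → ∃ x, fE x = e

namespace LeafExt

variable {X : LGraph LV LE} {Y : LGraph LV' LE'}

theorem src_ne_leaf (F : LeafExt X Y) (e : Y.E) : Y.src e ≠ Y.tgt F.leafE := by
  by_cases h : e = F.leafE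
  · rw [h, F.src_leaf]; exact F.tgt_leaf _
  · obtain ⟨x, rfl⟩ := F.surjE e h
    rw [← F.src_eq]; exact F.tgt_leaf _

theorem tgt_ne_leaf (F : LeafExt X Y) {e : Y.E} (h : e ≠ F.leafE) :
    Y.tgt e ≠ Y.tgt F.leafE := by
  obtain ⟨x, rfl⟩ := F.surjE e h
  rw [← F.tgt_eq]; exact F.tgt_leaf _

/-- A walk uses the leaf edge an even number of times iff both or neither of its ends are the
leaf. -/
theorem even_count [DecidableEq Y.E] (F : LeafExt X Y) {a b : Y.V} {es : List Y.E}
    (h : UWalk Y a b es) :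
    Even (es.count F.leafE) ↔ (a = Y.tgt F.leafE ↔ b = Y.tgt F.leafE) := by
  induction h with
  | nil v => simp
  -- Traversing the leaf edge switches between being at the leaf and being elsewhere; every other
  -- edge has both ends off the leaf.
  | fwd e _ ih =>
    have h1 := F.src_ne_leaf e
    by_cases h : e = F.leafE
    · subst h
      rw [List.count_cons_self, Nat.even_add_one, ih]
      tauto
    · rw [List.count_cons_of_ne h, ih]
      have := F.tgt_ne_leaf h
      tauto
  | bwd e _ ih =>
    have h1 := F.src_ne_leaf e
    by_cases h : e = F.leafE
    · subst h
      rw [List.count_cons_self, Nat.even_add_one, ih]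
      tauto
    · rw [List.count_cons_of_ne h, ih]
      have := F.tgt_ne_leaf h
      tauto

/-- All edges but the leaf edge come from `X`, so a walk that starts in `X` and avoids the leaf edge
stays in `X`. -/
theorem exists_walk_of_notMem (F : LeafExt X Y) {a b : Y.V} {es : List Y.E} (h : UWalk Y a b es)
    (he : F.leafE ∉ es) (x : X.V) (hx : F.fV x = a) :
    ∃ y fs, F.fV y = b ∧ es = fs.map F.fE ∧ UWalk X x y fs := by
  induction h generalizing x with
  | nil v => exact ⟨x, [], hx, rfl, .nil _⟩
  | fwd e _ ih =>
    rw [List.mem_cons, not_or] at he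
    obtain ⟨e', rfl⟩ := F.surjE e (Ne.symm he.1)
    rw [← F.src_eq] at hx
    obtain ⟨y, fs, rfl, rfl, hw⟩ := ih he.2 _ (F.tgt_eq e')
    exact ⟨y, e' :: fs, rfl, rfl, F.injV hx ▸ .fwd e' hw⟩
  | bwd e _ ih =>
    rw [List.mem_cons, not_or] at he
    obtain ⟨e', rfl⟩ := F.surjE e (Ne.symm he.1)
    rw [← F.tgt_eq] at hx
    obtain ⟨y, fs, rfl, rfl, hw⟩ := ih he.2 _ (F.src_eq e')
    exact ⟨y, e' :: fs, rfl, rfl, F.injV hx ▸ .bwd e' hw⟩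

open Classical in
/-- Contract the leaf edge. -/
noncomputable def retract (F : LeafExt X Y) (v : Y.V) : X.V :=
  if h : v = Y.tgt F.leafE then F.stem else (F.surjV v h).choose

theorem retract_leaf (F : LeafExt X Y) : F.retract (Y.tgt F.leafE) = F.stem := by
  simp [retract]

theorem retract_fV (F : LeafExt X Y) (x : X.V) : F.retract (F.fV x) = x := by
  rw [retract, dif_neg (F.tgt_leaf x)]
  exact F.injV (F.surjV _ (F.tgt_leaf x)).choose_spec

/-- Traversals of the leaf edge become trivial under contraction. Only connectedness is transferred
this way, so no control over the edge sequence is needed. -/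
theorem exists_walk_retract (F : LeafExt X Y) {a b : Y.V} {es : List Y.E} (h : UWalk Y a b es) :
    ∃ fs, UWalk X (F.retract a) (F.retract b) fs := by
  induction h with
  | nil v => exact ⟨[], .nil _⟩
  | fwd e _ ih =>
    obtain ⟨fs, hf⟩ := ih
    by_cases h : e = F.leafE
    · subst h
      rw [retract_leaf] at hf
      rw [F.src_leaf, retract_fV]
      exact ⟨fs, hf⟩
    · obtain ⟨e', rfl⟩ := F.surjE e h
      rw [← F.tgt_eq, retract_fV] at hf
      rw [← F.src_eq, retract_fV]
      exact ⟨_, .fwd e' hf⟩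
  | bwd e _ ih =>
    obtain ⟨fs, hf⟩ := ih
    by_cases h : e = F.leafE
    · subst h
      rw [F.src_leaf, retract_fV] at hf
      rw [retract_leaf]
      exact ⟨fs, hf⟩
    · obtain ⟨e', rfl⟩ := F.surjE e h
      rw [← F.src_eq, retract_fV] at hf
      rw [← F.tgt_eq, retract_fV]
      exact ⟨_, .bwd e' hf⟩

/-- Adding a leaf to a tree yields a tree. -/
theorem isTree (F : LeafExt X Y) (h : X.IsTree) : Y.IsTree := by
  classical
  obtain ⟨⟨v⟩, hc, ha, hd⟩ := h
  have key : ∀ v, ∃ x es es', UWalk Y v (F.fV x) es ∧ UWalk Y (F.fV x) v es' := by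
    intro v
    by_cases hv : v = Y.tgt F.leafE
    · subst hv
      refine ⟨F.stem, [F.leafE], [F.leafE], ?_, ?_⟩
      · rw [← F.src_leaf]; exact .bwd _ (.nil _)
      · rw [← F.src_leaf]; exact .fwd _ (.nil _)
    · obtain ⟨x, rfl⟩ := F.surjV v hv
      exact ⟨x, [], [], .nil _, .nil _⟩
  refine ⟨⟨F.fV v⟩, fun a b => ?_, fun a es hw hn => ?_, fun a => ?_⟩
  · obtain ⟨x, es, -, hx, -⟩ := key a
    obtain ⟨y, -, fs, -, hy⟩ := key b
    obtain ⟨gs, hg⟩ := hc x y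
    exact ⟨_, hx.append ((hg.map F.src_eq F.tgt_eq).append hy)⟩
  · have h1 := (F.even_count hw).2 Iff.rfl
    have h2 : F.leafE ∉ es := by
      intro h
      rw [List.count_eq_one_of_mem hn h] at h1
      exact absurd h1 (by decide)
    by_cases hv : a = Y.tgt F.leafE
    -- At the leaf there is no edge other than the leaf edge, so the walk cannot even start. The
    -- endpoint is generalized so that `cases` can unify the indices.
    · generalize hb : a = b at hw
      rw [hb] at hv
      cases hw with
      | nil => rfl
      | fwd e _ => exact absurd hv (F.src_ne_leaf e)
      | bwd e _ => exact absurd hv (F.tgt_ne_leaf fun h => h2 (by simp [h]))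
    · obtain ⟨x, rfl⟩ := F.surjV a hv
      obtain ⟨y, fs, hy, rfl, hf⟩ := F.exists_walk_of_notMem hw h2 x rfl
      rw [ha x fs (by rwa [F.injV hy] at hf) (hn.of_map _), List.map_nil]
  · rw [indeg_le_one_iff]
    intro e e' he he'
    by_cases h : e = F.leafE
    · by_contra hne
      exact F.tgt_ne_leaf (fun h' => hne (h.trans h'.symm)) (by rw [he', ← he, h])
    · by_cases h' : e' = F.leafE
      · exact absurd (by rw [he, ← he', h']) (F.tgt_ne_leaf h)
      · obtain ⟨x, rfl⟩ := F.surjE e h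
        obtain ⟨x', rfl⟩ := F.surjE e' h'
        rw [← F.tgt_eq] at he he'
        rw [indeg_le_one_iff.1 (hd (X.tgt x)) x x' rfl (F.injV (he'.trans he.symm))]

/-- Removing a leaf from a tree yields a tree. -/
theorem isTree_of_isTree (F : LeafExt X Y) (h : Y.IsTree) : X.IsTree := by
  obtain ⟨-, hc, ha, hd⟩ := h
  refine ⟨⟨F.stem⟩, fun a b => ?_, fun a es hw hn => ?_, fun a => ?_⟩
  · obtain ⟨es, h⟩ := hc (F.fV a) (F.fV b)
    obtain ⟨fs, hf⟩ := F.exists_walk_retract h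
    rw [retract_fV, retract_fV] at hf
    exact ⟨fs, hf⟩
  · simpa using ha _ _ (hw.map F.src_eq F.tgt_eq) (hn.map F.injE)
  · rw [indeg_le_one_iff]
    intro e e' he he'
    exact F.injE (indeg_le_one_iff.1 (hd (F.fV a)) _ _ (by rw [← F.tgt_eq, he])
      (by rw [← F.tgt_eq, he']))

open Classical in
/-- Two leaf extensions of a graph at the same node are isomorphic. -/
theorem isomorphic [Subsingleton LE'] {X : LGraph LV LE} {Y Z : LGraph LV' LE'}
    (F : LeafExt X Y) (F' : LeafExt X Z)
    (hstem : F.stem = F'.stem) {a : Option LV'} {b : Option Bool} (hl : ∀ v, Y.l v = a)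
    (hp : ∀ v, Y.p v = b) (hl' : ∀ v, Z.l v = a) (hp' : ∀ v, Z.p v = b) :
    Isomorphic Y Z := by
  -- Nodes and edges of a leaf extension are those of `X` plus one; `none` stands for the new one.
  have eqV : ∀ {Y : LGraph LV' LE'} (F : LeafExt X Y), Bijective
      (fun o : Option X.V => o.elim (Y.tgt F.leafE) F.fV) := by
    intro Y F
    constructor
    · rintro (_ | x) (_ | y) h
      · rfl
      · exact absurd h.symm (F.tgt_leaf _)
      · exact absurd h (F.tgt_leaf _)
      · exact congrArg some (F.injV h)
    · intro v
      by_cases h : v = Y.tgt F.leafE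
      · exact ⟨none, h.symm⟩
      · obtain ⟨x, hx⟩ := F.surjV v h
        exact ⟨some x, hx⟩
  have eqE : ∀ {Y : LGraph LV' LE'} (F : LeafExt X Y), Bijective
      (fun o : Option X.E => o.elim F.leafE F.fE) := by
    intro Y F
    constructor
    · rintro (_ | x) (_ | y) h
      · rfl
      · exact absurd h.symm (F.leafE_new _)
      · exact absurd h (F.leafE_new _)
      · exact congrArg some (F.injE h)
    · intro v
      by_cases h : v = F.leafE
      · exact ⟨none, h.symm⟩
      · obtain ⟨x, hx⟩ := F.surjE v h
        exact ⟨some x, hx⟩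
  let fV := (Equiv.ofBijective _ (eqV F)).symm.trans (Equiv.ofBijective _ (eqV F'))
  let fE := (Equiv.ofBijective _ (eqE F)).symm.trans (Equiv.ofBijective _ (eqE F'))
  have hV : ∀ x, fV (F.fV x) = F'.fV x := fun x => by
    have : (Equiv.ofBijective _ (eqV F)).symm (F.fV x) = some x :=
      (Equiv.symm_apply_eq _).2 rfl
    simp [fV, this]
  have hV' : fV (Y.tgt F.leafE) = Z.tgt F'.leafE := by
    have : (Equiv.ofBijective _ (eqV F)).symm (Y.tgt F.leafE) = none :=
      (Equiv.symm_apply_eq _).2 rfl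
    simp [fV, this]
  have hE : ∀ x, fE (F.fE x) = F'.fE x := fun x => by
    have : (Equiv.ofBijective _ (eqE F)).symm (F.fE x) = some x :=
      (Equiv.symm_apply_eq _).2 rfl
    simp [fE, this]
  have hE' : fE F.leafE = F'.leafE := by
    have : (Equiv.ofBijective _ (eqE F)).symm F.leafE = none :=
      (Equiv.symm_apply_eq _).2 rfl
    simp [fE, this]
  refine isomorphic_iff.2 ⟨fV, fE, fun e => ?_, fun e => ?_, fun _ => Subsingleton.elim _ _,
    fun v => by rw [hl, hl'], fun v => by rw [hp, hp']⟩
  · by_cases h : e = F.leafE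
    · rw [h, hE', F.src_leaf, F'.src_leaf, hV, hstem]
    · obtain ⟨x, rfl⟩ := F.surjE e h
      rw [hE, ← F.src_eq, ← F'.src_eq, hV]
  · by_cases h : e = F.leafE
    · rw [h, hE', hV']
    · obtain ⟨x, rfl⟩ := F.surjE e h
      rw [hE, ← F.tgt_eq, ← F'.tgt_eq, hV]

end LeafExt

/-! ## Graphs given by parts of another graph -/

/-- `M` is, up to isomorphism, the subgraph of `G` with node set `A` and edge set `B`, where the node
labels are given by `l` and rootedness by `p`. -/
structure Realizes (M G : LGraph LV LE) (A : Set G.V) (B : Set G.E) (l : G.V → Option LV)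
    (p : G.V → Option Bool) where
  fV : M.V → G.V
  fE : M.E → G.E
  injV : Injective fV
  injE : Injective fE
  src_eq : ∀ e, fV (M.src e) = G.src (fE e)
  tgt_eq : ∀ e, fV (M.tgt e) = G.tgt (fE e)
  m_eq : ∀ e, M.m e = G.m (fE e)
  l_eq : ∀ v, M.l v = l (fV v)
  p_eq : ∀ v, M.p v = p (fV v)
  rangeV : Set.range fV = A
  rangeE : Set.range fE = B

namespace Realizes

variable {M M' G : LGraph LV LE} {A : Set G.V} {B : Set G.E} {l : G.V → Option LV}
  {p : G.V → Option Bool}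

/-- The parts and labellings determine the graph up to isomorphism. This turns a description of one
rule result into a description of all graphs derived at that match. -/
theorem isomorphic (F : Realizes M G A B l p) (F' : Realizes M' G A B l p) :
    Isomorphic M M' := by
  let fV : M.V ≃ M'.V := (Equiv.ofInjective _ F.injV).trans
    ((Equiv.setCongr (F.rangeV.trans F'.rangeV.symm)).trans (Equiv.ofInjective _ F'.injV).symm)
  let fE : M.E ≃ M'.E := (Equiv.ofInjective _ F.injE).trans
    ((Equiv.setCongr (F.rangeE.trans F'.rangeE.symm)).trans (Equiv.ofInjective _ F'.injE).symm)
  have hV : ∀ x, F'.fV (fV x) = F.fV x := fun x => by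
    simp [fV, Equiv.apply_ofInjective_symm]
  have hE : ∀ x, F'.fE (fE x) = F.fE x := fun x => by
    simp [fE, Equiv.apply_ofInjective_symm]
  refine isomorphic_iff.2 ⟨fV, fE, fun e => F'.injV ?_, fun e => F'.injV ?_, fun e => ?_,
    fun v => ?_, fun v => ?_⟩
  · rw [hV, F.src_eq, F'.src_eq, hE]
  · rw [hV, F.tgt_eq, F'.tgt_eq, hE]
  · rw [F.m_eq, F'.m_eq, hE]
  · rw [F.l_eq, F'.l_eq, hV]
  · rw [F.p_eq, F'.p_eq, hV]

theorem of_isomorphic (F : Realizes M G A B l p) (h : Isomorphic M' M) :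
    Nonempty (Realizes M' G A B l p) := by
  obtain ⟨fV, fE, hs, ht, hm, hl, hp⟩ := isomorphic_iff.1 h
  exact ⟨{
    fV := F.fV ∘ fV
    fE := F.fE ∘ fE
    injV := F.injV.comp fV.injective
    injE := F.injE.comp fE.injective
    src_eq := fun e => by simp [hs, F.src_eq]
    tgt_eq := fun e => by simp [ht, F.tgt_eq]
    m_eq := fun e => by simp [hm, F.m_eq]
    l_eq := fun e => by simp [hl, F.l_eq]
    p_eq := fun e => by simp [hp, F.p_eq]
    rangeV := by rw [fV.surjective.range_comp, F.rangeV]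
    rangeE := by rw [fE.surjective.range_comp, F.rangeE] }⟩

end Realizes

end LGraph

/-! ## The effect of the rules -/

/-- The edge `e` leads from an unrooted node to a root labelled `□` without other incident edges. -/
structure Prunable (G : LGraph Mark Box) (e : G.E) : Prop where
  l_tgt : G.l (G.tgt e) = some .box
  p_tgt : G.p (G.tgt e) = some true
  l_src : ∃ a, G.l (G.src e) = some a
  p_src : G.p (G.src e) = some false
  isolated : ∀ x, x ≠ e → G.src x ≠ G.tgt e ∧ G.tgt x ≠ G.tgt e

open Classical in
/-- `M` arises from `G` by deleting `e` and its target and making its source a root labelled `□`. -/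
abbrev PruneResult (G : LGraph Mark Box) (e : G.E) (M : LGraph Mark Box) : Type :=
  Realizes M G {v | v ≠ G.tgt e} {x | x ≠ e} (update G.l (G.src e) (some .box))
    (update G.p (G.src e) (some true))

/-- The edge `e` leads from a root to an unrooted node, both labelled `□`. -/
structure Descendable (G : LGraph Mark Box) (e : G.E) : Prop where
  l_src : G.l (G.src e) = some .box
  p_src : G.p (G.src e) = some true
  l_tgt : G.l (G.tgt e) = some .box
  p_tgt : G.p (G.tgt e) = some false

open Classical in
/-- `M` arises from `G` by moving the root from the source of `e` to its target and relabelling the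
source. -/
abbrev DescendResult (G : LGraph Mark Box) (e : G.E) (M : LGraph Mark Box) : Type :=
  Realizes M G Set.univ Set.univ (update G.l (G.src e) (some .tri))
    (update (update G.p (G.src e) (some false)) (G.tgt e) (some true))

theorem Prunable.src_ne_tgt {G : LGraph Mark Box} {e : G.E} (h : Prunable G e) :
    G.src e ≠ G.tgt e := fun h' => by
  have := h.p_src
  rw [h', h.p_tgt] at this
  cases this

theorem Descendable.src_ne_tgt {G : LGraph Mark Box} {e : G.E} (h : Descendable G e) :
    G.src e ≠ G.tgt e := fun h' => by
  have := h.p_src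
  rw [h', h.p_tgt] at this
  cases this

section PruneRule

variable {a : Mark} {G : LGraph Mark Box}

theorem prunable_of_match (μ : Match (pruneRule a) G) : Prunable G (μ.g.fE ()) := by
  have hs : μ.g.fV (0 : Fin 2) = G.src (μ.g.fE ()) := μ.g.src_eq ()
  have ht : μ.g.fV (1 : Fin 2) = G.tgt (μ.g.fE ()) := μ.g.tgt_eq ()
  refine ⟨?_, ?_, ⟨a, ?_⟩, ?_, fun x hx => ?_⟩
  · rw [← ht]; exact μ.g.l_eq _ _ rfl
  · rw [← ht]; exact μ.g.p_eq _ _ rfl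
  · rw [← hs]; exact μ.g.l_eq _ _ rfl
  · rw [← hs]; exact μ.g.p_eq _ _ rfl
  · rw [← ht]
    -- Node `1` is not in the interface, so the dangling condition applies to it.
    exact μ.dangling x (fun y h => hx h.symm) (1 : Fin 2)
      (fun k h => absurd (show (0 : Fin 2) = 1 from h) (by decide))

theorem pruneResult_of_match (μ : Match (pruneRule a) G) :
    Nonempty (PruneResult G (μ.g.fE ()) μ.result) := by
  classical
  have hs : μ.g.fV (0 : Fin 2) = G.src (μ.g.fE ()) := μ.g.src_eq ()
  have ht : μ.g.fV (1 : Fin 2) = G.tgt (μ.g.fE ()) := μ.g.tgt_eq ()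
  have hV : ∀ v, μ.DelV v ↔ v = G.tgt (μ.g.fE ()) := by
    intro v
    constructor
    · rintro ⟨x, hx, rfl⟩
      have h0 : x ≠ (0 : Fin 2) := fun h => hx (0 : Fin 1) h.symm
      have : x = (1 : Fin 2) := (show ∀ y : Fin 2, y ≠ 0 → y = 1 by decide) x h0
      rw [this, ht]
    · rintro rfl
      exact ⟨(1 : Fin 2), fun k h => absurd (show (0 : Fin 2) = 1 from h) (by decide), ht⟩
  have hE : ∀ e, μ.DelE e ↔ e = μ.g.fE () := by
    intro e
    constructor
    · rintro ⟨x, hx, rfl⟩; rfl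
    · rintro rfl
      exact ⟨(), fun k => k.elim, rfl⟩
  -- Nothing lies in `R \ K`, so the result graph consists of retained items only.
  have eV : IsEmpty {x : (pruneRule a).R.V // ∀ k, (pruneRule a).right.fV k ≠ x} :=
    ⟨fun x => x.2 x.1 rfl⟩
  have eE : IsEmpty {x : (pruneRule a).R.E // ∀ k, (pruneRule a).right.fE k ≠ x} :=
    ⟨fun x => x.2 x.1 rfl⟩
  refine ⟨{
    fV := Sum.elim Subtype.val (fun x => (eV.false x).elim)
    fE := Sum.elim Subtype.val (fun x => (eE.false x).elim)
    injV := ?_, injE := ?_, src_eq := ?_, tgt_eq := ?_, m_eq := ?_, l_eq := ?_, p_eq := ?_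
    rangeV := ?_, rangeE := ?_ }⟩
  · rintro (x | x) (y | y) h
    · exact congrArg Sum.inl (Subtype.ext h)
    · exact (eV.false y).elim
    · exact (eV.false x).elim
    · exact (eV.false x).elim
  · rintro (x | x) (y | y) h
    · exact congrArg Sum.inl (Subtype.ext h)
    · exact (eE.false y).elim
    · exact (eE.false x).elim
    · exact (eE.false x).elim
  · rintro (x | x)
    · rfl
    · exact (eE.false x).elim
  · rintro (x | x)
    · rfl
    · exact (eE.false x).elim
  · intro _; exact Subsingleton.elim _ _
  · rintro (⟨x, hx⟩ | x)
    · by_cases h : x = G.src (μ.g.fE ())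
      · subst h
        have h : ∃ k, (pruneRule a).K.l k = none ∧
            μ.g.fV ((pruneRule a).left.fV k) = G.src (μ.g.fE ()) := ⟨(0 : Fin 1), rfl, hs⟩
        simp only [Sum.elim_inl, update_self]
        -- The label in `R` does not depend on the node, so it is irrelevant which interface node is
        -- chosen.
        exact dif_pos h
      · have h' : ¬ ∃ k, (pruneRule a).K.l k = none ∧
            μ.g.fV ((pruneRule a).left.fV k) = x := fun ⟨k, _, hk⟩ => h (hk.symm.trans hs)
        simp only [Sum.elim_inl, update_of_ne h]
        exact (dif_neg h').trans (if_neg h')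
    · exact (eV.false x).elim
  · rintro (⟨x, hx⟩ | x)
    · by_cases h : x = G.src (μ.g.fE ())
      · subst h
        have h : ∃ k, (pruneRule a).K.p k = none ∧
            μ.g.fV ((pruneRule a).left.fV k) = G.src (μ.g.fE ()) := ⟨(0 : Fin 1), rfl, hs⟩
        simp only [Sum.elim_inl, update_self]
        exact dif_pos h
      · have h' : ¬ ∃ k, (pruneRule a).K.p k = none ∧
            μ.g.fV ((pruneRule a).left.fV k) = x := fun ⟨k, _, hk⟩ => h (hk.symm.trans hs)
        simp only [Sum.elim_inl, update_of_ne h]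
        exact (dif_neg h').trans (if_neg h')
    · exact (eV.false x).elim
  · ext v
    constructor
    · rintro ⟨x | x, rfl⟩
      · exact fun h => x.2 ((hV _).2 h)
      · exact (eV.false x).elim
    · intro h
      exact ⟨Sum.inl ⟨v, fun h' => h ((hV v).1 h')⟩, rfl⟩
  · ext v
    constructor
    · rintro ⟨x | x, rfl⟩
      · exact fun h => x.2 ((hE _).2 h)
      · exact (eE.false x).elim
    · intro h
      exact ⟨Sum.inl ⟨v, fun h' => h ((hE v).1 h')⟩, rfl⟩

theorem exists_match_prune {e : G.E} (h : Prunable G e) (ha : G.l (G.src e) = some a) :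
    ∃ μ : Match (pruneRule a) G, μ.g.fE () = e := by
  refine ⟨{
    g := {
      fV := (![G.src e, G.tgt e] : Fin 2 → G.V)
      fE := fun _ => e
      src_eq := fun _ => rfl
      tgt_eq := fun _ => rfl
      m_eq := fun _ => Subsingleton.elim _ _
      l_eq := ?_
      p_eq := ?_ }
    inj := ⟨?_, fun _ _ _ => rfl⟩
    dangling := ?_ }, rfl⟩
  · intro (v : Fin 2) b hb
    change some ((![a, .box] : Fin 2 → Mark) v) = some b at hb
    fin_cases v
    · exact ha.trans hb
    · exact h.l_tgt.trans hb
  · intro (v : Fin 2) b hb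
    change some ((![false, true] : Fin 2 → Bool) v) = some b at hb
    fin_cases v
    · exact h.p_src.trans hb
    · exact h.p_tgt.trans hb
  · intro (x : Fin 2) (y : Fin 2) hxy
    change (![G.src e, G.tgt e] : Fin 2 → G.V) x = (![G.src e, G.tgt e] : Fin 2 → G.V) y at hxy
    have := h.src_ne_tgt
    fin_cases x <;> fin_cases y
    · rfl
    · exact absurd hxy this
    · exact absurd hxy.symm this
    · rfl
  · intro x hx (y : Fin 2) hy
    have hy0 : y ≠ 0 := fun h => hy (0 : Fin 1) h.symm
    obtain rfl : y = 1 := by omega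
    exact h.isolated x fun h => hx () h.symm

end PruneRule

section R2

variable {G : LGraph Mark Box}

theorem descendable_of_match (μ : Match r2 G) : Descendable G (μ.g.fE ()) := by
  have hs : μ.g.fV (0 : Fin 2) = G.src (μ.g.fE ()) := μ.g.src_eq ()
  have ht : μ.g.fV (1 : Fin 2) = G.tgt (μ.g.fE ()) := μ.g.tgt_eq ()
  refine ⟨?_, ?_, ?_, ?_⟩
  · rw [← hs]; exact μ.g.l_eq _ _ rfl
  · rw [← hs]; exact μ.g.p_eq _ _ rfl
  · rw [← ht]; exact μ.g.l_eq _ _ rfl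
  · rw [← ht]; exact μ.g.p_eq _ _ rfl

theorem descendResult_of_match (μ : Match r2 G) :
    Nonempty (DescendResult G (μ.g.fE ()) μ.result) := by
  classical
  have hs : μ.g.fV (0 : Fin 2) = G.src (μ.g.fE ()) := μ.g.src_eq ()
  have ht : μ.g.fV (1 : Fin 2) = G.tgt (μ.g.fE ()) := μ.g.tgt_eq ()
  have hne := (descendable_of_match μ).src_ne_tgt
  have hV : ∀ v, ¬ μ.DelV v := by
    rintro v ⟨x, hx, rfl⟩
    exact hx x rfl
  have hE : ∀ e, μ.DelE e ↔ e = μ.g.fE () := by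
    intro e
    constructor
    · rintro ⟨x, hx, rfl⟩; rfl
    · rintro rfl
      exact ⟨(), fun k => k.elim, rfl⟩
  have eV : IsEmpty {x : r2.R.V // ∀ k, r2.right.fV k ≠ x} := ⟨fun x => x.2 x.1 rfl⟩
  have hplace : ∀ x : Fin 2, μ.place x = Sum.inl ⟨μ.g.fV x, hV _⟩ := by
    intro x
    have h : ∃ k, r2.right.fV k = x := ⟨x, rfl⟩
    refine (dif_pos h).trans (congrArg Sum.inl (Subtype.ext ?_))
    exact congrArg μ.g.fV h.choose_spec
  have hlab : ∀ x : Fin 2, ∃ k, r2.K.l k = none ∧ μ.g.fV (r2.left.fV k) = μ.g.fV x :=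
    fun x => ⟨x, rfl, rfl⟩
  have hroot : ∀ x : Fin 2, ∃ k, r2.K.p k = none ∧ μ.g.fV (r2.left.fV k) = μ.g.fV x :=
    fun x => ⟨x, rfl, rfl⟩
  -- Here the two nodes of `R` carry different labels; injectivity of the match forces the chosen
  -- interface node to be the right one.
  have hcl : ∀ x : Fin 2, (hlab x).choose = x :=
    fun x => μ.inj.1 (hlab x).choose_spec.2
  have hcp : ∀ x : Fin 2, (hroot x).choose = x :=
    fun x => μ.inj.1 (hroot x).choose_spec.2
  refine ⟨{
    fV := Sum.elim Subtype.val (fun x => (eV.false x).elim)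
    -- The edge added by the rule takes the place of the deleted matched edge, so the underlying
    -- graph is unchanged.
    fE := Sum.elim Subtype.val (fun x => μ.g.fE ())
    injV := ?_, injE := ?_, src_eq := ?_, tgt_eq := ?_, m_eq := ?_, l_eq := ?_, p_eq := ?_
    rangeV := ?_, rangeE := ?_ }⟩
  · rintro (x | x) (y | y) h
    · exact congrArg Sum.inl (Subtype.ext h)
    · exact (eV.false y).elim
    · exact (eV.false x).elim
    · exact (eV.false x).elim
  · rintro (x | x) (y | y) h
    · exact congrArg Sum.inl (Subtype.ext h)
    · exact (x.2 ((hE _).2 h)).elim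
    · exact (y.2 ((hE _).2 h.symm)).elim
    · exact congrArg Sum.inr (Subtype.ext rfl)
  · rintro (x | x)
    · rfl
    · exact (congrArg _ (hplace 0)).trans hs
  · rintro (x | x)
    · rfl
    · exact (congrArg _ (hplace 1)).trans ht
  · intro _; exact Subsingleton.elim _ _
  · rintro (⟨x, hx⟩ | x)
    · by_cases h : x = G.src (μ.g.fE ())
      · obtain rfl := h.trans hs.symm
        rw [Sum.elim_inl, ← hs, update_self]
        exact (dif_pos (hlab 0)).trans (congrArg r2.R.l (hcl 0))
      · by_cases h2 : x = G.tgt (μ.g.fE ())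
        · obtain rfl := h2.trans ht.symm
          rw [Sum.elim_inl, update_of_ne h]
          -- The rule rewrites this label to `□`, which it already was; `DescendResult` therefore
          -- does not mention it.
          rw [show G.l (μ.g.fV (1 : Fin 2)) = some Mark.box from μ.g.l_eq _ _ rfl]
          exact (dif_pos (hlab 1)).trans (congrArg r2.R.l (hcl 1))
        · have h' : ¬ ∃ k, r2.K.l k = none ∧ μ.g.fV (r2.left.fV k) = x := by
            rintro ⟨(k : Fin 2), _, hk⟩
            fin_cases k
            · exact h (hk.symm.trans hs)
            · exact h2 (hk.symm.trans ht)
          rw [Sum.elim_inl, update_of_ne h]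
          exact (dif_neg h').trans (if_neg h')
    · exact (eV.false x).elim
  · rintro (⟨x, hx⟩ | x)
    · by_cases h2 : x = G.tgt (μ.g.fE ())
      · obtain rfl := h2.trans ht.symm
        rw [Sum.elim_inl, ← ht, update_self]
        exact (dif_pos (hroot 1)).trans (congrArg r2.R.p (hcp 1))
      · by_cases h : x = G.src (μ.g.fE ())
        · obtain rfl := h.trans hs.symm
          rw [Sum.elim_inl, update_of_ne h2, ← hs, update_self]
          exact (dif_pos (hroot 0)).trans (congrArg r2.R.p (hcp 0))
        · have h' : ¬ ∃ k, r2.K.p k = none ∧ μ.g.fV (r2.left.fV k) = x := by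
            rintro ⟨(k : Fin 2), _, hk⟩
            fin_cases k
            · exact h (hk.symm.trans hs)
            · exact h2 (hk.symm.trans ht)
          rw [Sum.elim_inl, update_of_ne h2, update_of_ne h]
          exact (dif_neg h').trans (if_neg h')
    · exact (eV.false x).elim
  · exact Set.eq_univ_of_forall fun v => ⟨Sum.inl ⟨v, hV v⟩, rfl⟩
  · refine Set.eq_univ_of_forall fun v => ?_
    by_cases h : v = μ.g.fE ()
    · exact ⟨Sum.inr ⟨(), fun k => k.elim⟩, h.symm⟩
    · exact ⟨Sum.inl ⟨v, fun h' => h ((hE v).1 h')⟩, rfl⟩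

theorem exists_match_r2 {e : G.E} (h : Descendable G e) :
    ∃ μ : Match r2 G, μ.g.fE () = e := by
  refine ⟨{
    g := {
      fV := (![G.src e, G.tgt e] : Fin 2 → G.V)
      fE := fun _ => e
      src_eq := fun _ => rfl
      tgt_eq := fun _ => rfl
      m_eq := fun _ => Subsingleton.elim _ _
      l_eq := ?_
      p_eq := ?_ }
    inj := ⟨?_, fun _ _ _ => rfl⟩
    dangling := fun x hx y hy => absurd rfl (hy y) }, rfl⟩
  · intro (v : Fin 2) b hb
    change some ((![.box, .box] : Fin 2 → Mark) v) = some b at hb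
    fin_cases v
    · exact h.l_src.trans hb
    · exact h.l_tgt.trans hb
  · intro (v : Fin 2) b hb
    change some ((![true, false] : Fin 2 → Bool) v) = some b at hb
    fin_cases v
    · exact h.p_src.trans hb
    · exact h.p_tgt.trans hb
  · intro (x : Fin 2) (y : Fin 2) hxy
    change (![G.src e, G.tgt e] : Fin 2 → G.V) x = (![G.src e, G.tgt e] : Fin 2 → G.V) y at hxy
    have := h.src_ne_tgt
    fin_cases x <;> fin_cases y
    · rfl
    · exact absurd hxy this
    · exact absurd hxy.symm this
    · rfl

end R2

/-- Direct derivations of the tree recognition system in terms of the edge that is matched. -/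
theorem directDerivation_treeRules_iff {G M : LGraph Mark Box} :
    DirectDerivation treeRules G M ↔
      ∃ e, (Prunable G e ∧ Nonempty (PruneResult G e M)) ∨
        (Descendable G e ∧ Nonempty (DescendResult G e M)) := by
  constructor
  · have prune : ∀ a (μ : Match (pruneRule a) G), Isomorphic M μ.result →
        ∃ e, Prunable G e ∧ Nonempty (PruneResult G e M) := fun a μ h =>
      ⟨_, prunable_of_match μ, (pruneResult_of_match μ).some.of_isomorphic h⟩
    rintro ⟨r, rfl | rfl | rfl, μ, h⟩
    · exact (prune _ μ h).imp fun _ => Or.inl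
    · exact (prune _ μ h).imp fun _ => Or.inl
    · exact ⟨_, Or.inr ⟨descendable_of_match μ,
        (descendResult_of_match μ).some.of_isomorphic h⟩⟩
  · rintro ⟨e, ⟨h, ⟨F⟩⟩ | ⟨h, ⟨F⟩⟩⟩
    · obtain ⟨a, ha⟩ := h.l_src
      obtain ⟨μ, rfl⟩ := exists_match_prune h ha
      refine ⟨pruneRule a, ?_, μ, F.isomorphic (pruneResult_of_match μ).some⟩
      cases a
      · exact Or.inl rfl
      · exact Or.inr (Or.inl rfl)
    · obtain ⟨μ, rfl⟩ := exists_match_r2 h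
      exact ⟨r2, Or.inr (Or.inr rfl), μ, F.isomorphic (descendResult_of_match μ).some⟩

theorem inNormalForm_treeRules_iff {G : LGraph Mark Box} :
    InNormalForm treeRules G ↔ ∀ e, ¬ Prunable G e ∧ ¬ Descendable G e := by
  constructor
  · refine fun h e => ⟨fun he => h ?_, fun he => h ?_⟩
    · obtain ⟨a, ha⟩ := he.l_src
      obtain ⟨μ, rfl⟩ := exists_match_prune he ha
      exact ⟨μ.result, directDerivation_treeRules_iff.2
        ⟨_, Or.inl ⟨he, pruneResult_of_match μ⟩⟩⟩
    · obtain ⟨μ, rfl⟩ := exists_match_r2 he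
      exact ⟨μ.result, directDerivation_treeRules_iff.2
        ⟨_, Or.inr ⟨he, descendResult_of_match μ⟩⟩⟩
  · rintro h ⟨M, hM⟩
    obtain ⟨e, he | he⟩ := directDerivation_treeRules_iff.1 hM
    · exact (h e).1 he.1
    · exact (h e).2 he.1

/-! ## The tree grammar -/

/-- All nodes are unrooted and labelled `□`. -/
def LGraph.IsPlain (X : LGraph Box Box) : Prop :=
  (∀ v, X.l v = some .box) ∧ ∀ v, X.p v = some false

theorem LGraph.IsPlain.of_isomorphic {X Y : LGraph Box Box} (h : X.IsPlain)
    (hY : Isomorphic X Y) : Y.IsPlain := by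
  obtain ⟨fV, fE, -, -, -, hl, hp⟩ := isomorphic_iff.1 hY
  refine ⟨fun v => ?_, fun v => ?_⟩
  · rw [← fV.apply_symm_apply v, ← hl, h.1]
  · rw [← fV.apply_symm_apply v, ← hp, h.2]

theorem LGraph.IsTree.of_isomorphic {LV LE : Type} {X Y : LGraph LV LE} (h : X.IsTree)
    (hY : Isomorphic X Y) : Y.IsTree := by
  obtain ⟨fV, fE, hs, ht, -⟩ := isomorphic_iff.1 hY
  exact h.of_equiv fV fE hs ht

section TreeRule

variable {X : LGraph Box Box} (μ : Match treeRule X)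

theorem not_delV_treeRule (v : X.V) : ¬ μ.DelV v := by
  rintro ⟨x, hx, -⟩
  exact hx x rfl

theorem not_delE_treeRule (e : X.E) : ¬ μ.DelE e := by
  rintro ⟨x, -, -⟩
  exact x.elim

theorem one_notMem_treeRule (k : treeRule.K.V) : treeRule.right.fV k ≠ (1 : Fin 2) :=
  fun h => absurd (show (0 : Fin 2) = 1 from h) (by decide)

theorem place_treeRule_zero :
    μ.place (0 : Fin 2) = Sum.inl ⟨μ.g.fV (0 : Fin 1), not_delV_treeRule μ _⟩ := by
  have h : ∃ k, treeRule.right.fV k = (0 : Fin 2) := ⟨(0 : Fin 1), rfl⟩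
  refine (dif_pos h).trans (congrArg Sum.inl (Subtype.ext ?_))
  exact congrArg μ.g.fV (Subsingleton.elim (α := Fin 1) _ _)

theorem place_treeRule_one :
    μ.place (1 : Fin 2) = Sum.inr ⟨(1 : Fin 2), one_notMem_treeRule⟩ :=
  dif_neg fun ⟨k, hk⟩ => one_notMem_treeRule k hk

/-- The rule of the tree grammar adds a leaf. -/
def leafExtOfMatch : LeafExt X μ.result where
  fV v := Sum.inl ⟨v, not_delV_treeRule μ v⟩
  fE e := Sum.inl ⟨e, not_delE_treeRule μ e⟩
  injV v w h := congrArg Subtype.val (Sum.inl_injective h)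
  injE v w h := congrArg Subtype.val (Sum.inl_injective h)
  src_eq _ := rfl
  tgt_eq _ := rfl
  leafE := Sum.inr ⟨(), fun k => k.elim⟩
  stem := μ.g.fV (0 : Fin 1)
  src_leaf := place_treeRule_zero μ
  tgt_leaf v h := by
    have := h.trans (place_treeRule_one μ)
    cases this
  leafE_new x h := by cases h
  surjV := by
    rintro (v | ⟨(v : Fin 2), hv⟩) h
    · exact ⟨v.1, rfl⟩
    · refine absurd ?_ h
      have hv' : v = 1 :=
        (show ∀ y : Fin 2, y ≠ 0 → y = 1 by decide) v fun h0 => hv (0 : Fin 1) h0.symm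
      subst hv'
      exact (place_treeRule_one μ).symm
  surjE := by
    rintro (v | ⟨v, hv⟩) h
    · exact ⟨v.1, rfl⟩
    · exact absurd rfl h

theorem isPlain_result_treeRule (hX : X.IsPlain) : μ.result.IsPlain := by
  constructor
  · rintro (v | v)
    -- The interface node of this rule is labelled and unrooted, so no label or rootedness is reset.
    · refine (dif_neg ?_).trans ((if_neg ?_).trans (hX.1 v.1)) <;>
      · rintro ⟨k, hk, -⟩
        cases hk
    · rfl
  · rintro (v | v)
    · refine (dif_neg ?_).trans ((if_neg ?_).trans (hX.2 v.1)) <;>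
      · rintro ⟨k, hk, -⟩
        cases hk
    · change some ((![false, false] : Fin 2 → Bool) v.1) = some false
      have : ∀ y : Fin 2, (![false, false] : Fin 2 → Bool) y = false := by decide
      exact congrArg some (this v.1)

end TreeRule

theorem DirectDerivation.isPlain_and_isTree {X Y : LGraph Box Box}
    (h : DirectDerivation TREE.rules X Y) (hX : X.IsPlain ∧ X.IsTree) :
    Y.IsPlain ∧ Y.IsTree := by
  obtain ⟨r, rfl, μ, h⟩ := h
  exact ⟨(isPlain_result_treeRule μ hX.1).of_isomorphic h.symm,
    ((leafExtOfMatch μ).isTree hX.2).of_isomorphic h.symm⟩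

/-- Applying the rule at the stem gives another leaf extension of `X` at the same node, and the two
are isomorphic. -/
theorem LGraph.LeafExt.directDerivation {X Y : LGraph Box Box} (F : LeafExt X Y)
    (hX : X.IsPlain) (hY : Y.IsPlain) : DirectDerivation TREE.rules X Y := by
  let μ : Match treeRule X := {
    g := {
      fV := fun _ => F.stem
      fE := fun e => e.elim
      src_eq := fun e => e.elim
      tgt_eq := fun e => e.elim
      m_eq := fun e => e.elim
      l_eq := fun _ _ h => (hX.1 _).trans h
      p_eq := fun _ _ h => (hX.2 _).trans h }
    inj := ⟨fun x y _ => Subsingleton.elim (α := Fin 1) x y, fun e => e.elim⟩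
    dangling := fun e he x hx => absurd rfl (hx x) }
  have hR := isPlain_result_treeRule μ hX
  exact ⟨treeRule, rfl, μ,
    F.isomorphic (leafExtOfMatch μ) rfl hY.1 hY.2 hR.1 hR.2⟩

theorem DerivesIn.trans_isomorphic {LV LE : Type} {R : Set (Rule LV LE)} {n : ℕ}
    {G H H' : LGraph LV LE} (h : DerivesIn R n G H) (hH : Isomorphic H H') :
    DerivesIn R n G H' := by
  cases n with
  | zero => exact Isomorphic.trans h hH
  | succ n =>
    obtain ⟨M, hM, r, hr, μ, hμ⟩ := h
    exact ⟨M, hM, r, hr, μ, hH.symm.trans hμ⟩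

theorem isTree_single {LV LE : Type} (a : Option LV) (b : Option Bool) :
    (discrete (LE := LE) 1 a b).IsTree := by
  refine ⟨⟨(0 : Fin 1)⟩, fun u v => ⟨[], ?_⟩, fun v es _ _ => ?_, fun v => ?_⟩
  · rw [Subsingleton.elim (α := Fin 1) u v]; exact .nil _
  · cases es with
    | nil => rfl
    | cons e _ => exact e.elim
  · rw [indeg_le_one_iff]
    rintro ⟨⟩

theorem mem_language_TREE_iff {X : LGraph Box Box} :
    X.cls ∈ TREE.language ↔ Derives TREE.rules TREE.start X := by
  constructor
  · rintro ⟨Y, hXY, ⟨n, hn⟩, -⟩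
    exact ⟨n, hn.trans_isomorphic (Isomorphic.symm (Quotient.exact hXY))⟩
  · exact fun h => ⟨X, rfl, h, fun _ _ _ h => h, fun _ h => h⟩

theorem Derives.isTree {X : LGraph Box Box} (h : Derives TREE.rules TREE.start X) :
    X.IsPlain ∧ X.IsTree := by
  obtain ⟨n, hn⟩ := h
  induction n generalizing X with
  | zero =>
    have h0 : TREE.start.IsPlain := ⟨fun _ => rfl, fun _ => rfl⟩
    exact ⟨h0.of_isomorphic hn, (isTree_single _ _).of_isomorphic hn⟩
  | succ n ih =>
    obtain ⟨M, hM, h⟩ := hn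
    exact h.isPlain_and_isTree (ih hM)

/-! ## Derivations of the tree recognition system -/

theorem isPlain_unlabel {LV LE : Type} (G : LGraph LV LE) : (unlabel G).IsPlain :=
  ⟨fun _ => rfl, fun _ => rfl⟩

theorem isomorphic_unlabel {LV LE : Type} {G H : LGraph LV LE} (h : Isomorphic G H) :
    Isomorphic (unlabel G) (unlabel H) := by
  obtain ⟨fV, fE, hs, ht, -⟩ := isomorphic_iff.1 h
  exact isomorphic_iff.2 ⟨fV, fE, hs, ht, fun _ => rfl, fun _ => rfl, fun _ => rfl⟩

namespace LGraph

variable {G M : LGraph Mark Box} {e : G.E}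

/-- Undoing a pruning step adds a leaf. -/
noncomputable def Realizes.leafExt (F : PruneResult G e M) (h : Prunable G e) :
    LeafExt (unlabel M) (unlabel G) :=
  have hV : ∀ v, v ≠ G.tgt e → ∃ x, F.fV x = v := fun v hv =>
    (Set.ext_iff.1 F.rangeV v).2 hv
  { fV := F.fV
    fE := F.fE
    injV := F.injV
    injE := F.injE
    src_eq := F.src_eq
    tgt_eq := F.tgt_eq
    leafE := e
    stem := (hV _ h.src_ne_tgt).choose
    src_leaf := (hV _ h.src_ne_tgt).choose_spec.symm
    tgt_leaf := fun x => (Set.ext_iff.1 F.rangeV _).1 ⟨x, rfl⟩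
    leafE_new := fun x => (Set.ext_iff.1 F.rangeE _).1 ⟨x, rfl⟩
    surjV := hV
    surjE := fun x hx => (Set.ext_iff.1 F.rangeE x).2 hx }

theorem Realizes.isomorphic_unlabel {l : G.V → Option Mark} {p : G.V → Option Bool}
    (F : Realizes M G Set.univ Set.univ l p) : Isomorphic (unlabel M) (unlabel G) :=
  isomorphic_iff.2 ⟨Equiv.ofBijective F.fV ⟨F.injV, Set.range_eq_univ.1 F.rangeV⟩,
    Equiv.ofBijective F.fE ⟨F.injE, Set.range_eq_univ.1 F.rangeE⟩, F.src_eq, F.tgt_eq,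
    fun _ => rfl, fun _ => rfl, fun _ => rfl⟩

end LGraph

/-- Pruning removes a leaf, and descending changes labels only. -/
theorem DirectDerivation.isTree_unlabel {G M : LGraph Mark Box}
    (h : DirectDerivation treeRules G M) (hG : (unlabel G).IsTree) : (unlabel M).IsTree := by
  obtain ⟨e, ⟨h, ⟨F⟩⟩ | ⟨h, ⟨F⟩⟩⟩ := directDerivation_treeRules_iff.1 h
  · exact (F.leafExt h).isTree_of_isTree hG
  · exact hG.of_isomorphic F.isomorphic_unlabel.symm

/-- A pruning step read backwards is a step of the tree grammar; a descending step read backwards is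
an isomorphism. -/
theorem DirectDerivation.derives_unlabel {G M : LGraph Mark Box}
    (h : DirectDerivation treeRules G M) (hM : Derives TREE.rules TREE.start (unlabel M)) :
    Derives TREE.rules TREE.start (unlabel G) := by
  obtain ⟨n, hn⟩ := hM
  obtain ⟨e, ⟨h, ⟨F⟩⟩ | ⟨h, ⟨F⟩⟩⟩ := directDerivation_treeRules_iff.1 h
  · exact ⟨n + 1, unlabel M, hn,
      (F.leafExt h).directDerivation (isPlain_unlabel _) (isPlain_unlabel _)⟩
  · exact ⟨n, hn.trans_isomorphic F.isomorphic_unlabel⟩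

theorem DerivesIn.isTree_unlabel {n : ℕ} {G H : LGraph Mark Box}
    (h : DerivesIn treeRules n G H) (hG : (unlabel G).IsTree) : (unlabel H).IsTree := by
  induction n generalizing H with
  | zero => exact hG.of_isomorphic (isomorphic_unlabel h)
  | succ n ih =>
    obtain ⟨M, hM, h⟩ := h
    exact h.isTree_unlabel (ih hM)

theorem DerivesIn.derives_unlabel {n : ℕ} {G H : LGraph Mark Box}
    (h : DerivesIn treeRules n G H) (hH : Derives TREE.rules TREE.start (unlabel H)) :
    Derives TREE.rules TREE.start (unlabel G) := by
  induction n generalizing H with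
  | zero =>
    obtain ⟨m, hm⟩ := hH
    exact ⟨m, hm.trans_isomorphic (isomorphic_unlabel (Isomorphic.symm h))⟩
  | succ n ih =>
    obtain ⟨M, hM, h⟩ := h
    exact ih hM (h.derives_unlabel hH)

/-! ### Termination -/

theorem card_lt_card_of_injective {α β : Type} [Finite β] (f : α → β) (hf : Injective f) {b : β}
    (hb : b ∉ Set.range f) : Nat.card α < Nat.card β := by
  have := Finite.of_injective f hf
  have := Fintype.ofFinite α
  have := Fintype.ofFinite β
  rw [Nat.card_eq_fintype_card, Nat.card_eq_fintype_card]
  exact Fintype.card_lt_of_injective_of_notMem f hf hb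

/-- The number of nodes plus the number of nodes labelled `□`. -/
noncomputable def weight (G : LGraph Mark Box) : ℕ :=
  G.order + Nat.card {v // G.l v = some .box}

theorem weight_congr {G H : LGraph Mark Box} (h : Isomorphic G H) : weight G = weight H := by
  obtain ⟨fV, -, -, -, -, hl, -⟩ := isomorphic_iff.1 h
  rw [weight, weight, order, order, Nat.card_congr fV,
    Nat.card_congr (fV.subtypeEquiv (q := fun v => H.l v = some .box) fun v => by rw [hl])]

/-- Pruning loses a node, and `□`-nodes do not become more numerous: the parent may turn `□`, but
the deleted root was `□`. Descending keeps the nodes and turns one `□` into `△`. -/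
theorem DirectDerivation.weight_lt {G M : LGraph Mark Box}
    (h : DirectDerivation treeRules G M) : weight M < weight G := by
  classical
  have := G.finV
  have := M.finV
  obtain ⟨e, ⟨h, ⟨F⟩⟩ | ⟨h, ⟨F⟩⟩⟩ := directDerivation_treeRules_iff.1 h
  · have h1 : M.order < G.order := by
      refine card_lt_card_of_injective (b := G.tgt e) F.fV F.injV ?_
      rw [F.rangeV]
      simp
    have h2 : Nat.card {v // M.l v = some .box} ≤ Nat.card {v // G.l v = some .box} := by
      -- The new root, which need not have been `□` before, is charged to the deleted one.
      refine Nat.card_le_card_of_injective (fun v => if hv : F.fV v.1 = G.src e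
        then ⟨G.tgt e, h.l_tgt⟩ else ⟨F.fV v.1, ?_⟩) ?_
      · have := v.2
        rwa [F.l_eq, update_of_ne hv] at this
      · have ht : ∀ x, F.fV x ≠ G.tgt e := fun x => (Set.ext_iff.1 F.rangeV _).1 ⟨x, rfl⟩
        intro v w hvw
        refine Subtype.ext (F.injV ?_)
        dsimp only at hvw
        split_ifs at hvw with h1 h2 h2
        · rw [h1, h2]
        · exact absurd (congrArg Subtype.val hvw).symm (ht _)
        · exact absurd (congrArg Subtype.val hvw) (ht _)
        · exact congrArg Subtype.val hvw
    exact add_lt_add_of_lt_of_le h1 h2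
  · have h1 : M.order = G.order :=
      Nat.card_congr (Equiv.ofBijective F.fV ⟨F.injV, Set.range_eq_univ.1 F.rangeV⟩)
    have key : ∀ v, M.l v = some .box → G.l (F.fV v) = some .box ∧ F.fV v ≠ G.src e := by
      intro v hv
      rw [F.l_eq, update_apply] at hv
      split_ifs at hv with h
      · cases hv
      · exact ⟨hv, h⟩
    have h2 : Nat.card {v // M.l v = some .box} < Nat.card {v // G.l v = some .box} := by
      refine card_lt_card_of_injective (b := ⟨G.src e, h.l_src⟩)
        (fun v => ⟨F.fV v.1, (key v.1 v.2).1⟩)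
        (fun v w h => Subtype.ext (F.injV (congrArg Subtype.val h))) ?_
      rintro ⟨v, hv⟩
      exact (key v.1 v.2).2 (congrArg Subtype.val hv)
    rw [weight, weight, h1]
    exact Nat.add_lt_add_left h2 _

theorem DerivesIn.add_weight_le {n : ℕ} {G H : LGraph Mark Box}
    (h : DerivesIn treeRules n G H) : n + weight H ≤ weight G := by
  induction n generalizing H with
  | zero => rw [weight_congr h, zero_add]
  | succ n ih =>
    obtain ⟨M, hM, h⟩ := h
    have := ih hM
    have := h.weight_lt
    omega

theorem IsInputGraph.weight_eq {G : LGraph Mark Box} (h : IsInputGraph G) :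
    weight G = 2 * G.order := by
  rw [weight, order, Nat.card_congr (Equiv.subtypeUnivEquiv h.2.2.1), two_mul]

theorem exists_isNormalFormOf (G : LGraph Mark Box) : ∃ H, IsNormalFormOf treeRules H G := by
  suffices ∀ n M, weight M ≤ n → Derives treeRules G M → ∃ H, IsNormalFormOf treeRules H G from
    this _ G le_rfl ⟨0, Isomorphic.refl G⟩
  intro n
  induction n with
  | zero =>
    refine fun M hM h => ⟨M, h, fun ⟨M', h'⟩ => ?_⟩
    have := h'.weight_lt
    omega
  | succ n ih =>
    rintro M hM ⟨k, hk⟩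
    by_cases hn : InNormalForm treeRules M
    · exact ⟨M, ⟨k, hk⟩, hn⟩
    · rw [InNormalForm, not_not] at hn
      obtain ⟨M', h'⟩ := hn
      exact ih M' (by have := h'.weight_lt; omega) ⟨k + 1, M, hk, h'⟩

/-! ### The root invariant and correctness -/

/-- The invariant of derivations from input graphs: there is exactly one root, it is labelled `□`,
and it can be reached from every node labelled `△`. -/
structure WellRooted (G : LGraph Mark Box) (r : G.V) : Prop where
  lab : ∀ v, ∃ a, G.l v = some a
  rooted : ∀ v, ∃ b, G.p v = some b
  l_root : G.l r = some .box
  p_iff : ∀ v, G.p v = some true ↔ v = r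
  reach : ∀ v, G.l v = some .tri → Relation.ReflTransGen G.Arc v r

theorem IsInputGraph.wellRooted {G : LGraph Mark Box} (h : IsInputGraph G) :
    ∃ r, WellRooted G r := by
  obtain ⟨h1, ⟨r, hr, hu⟩, hl, -⟩ := h
  refine ⟨r, fun v => ⟨_, hl v⟩, fun v => Option.ne_none_iff_exists'.1 (h1.2 v), hl r,
    fun v => ⟨hu v, fun h => h ▸ hr⟩, fun v hv => ?_⟩
  rw [hl] at hv
  cases hv

namespace WellRooted

variable {G M : LGraph Mark Box} {r : G.V}

theorem p_false (h : WellRooted G r) {v : G.V} (hv : v ≠ r) : G.p v = some false := by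
  obtain ⟨b, hb⟩ := h.rooted v
  cases b
  · exact hb
  · exact absurd ((h.p_iff v).1 hb) hv

theorem of_isomorphic (h : WellRooted G r) (hM : Isomorphic G M) : ∃ r', WellRooted M r' := by
  obtain ⟨fV, fE, hs, ht, -, hl, hp⟩ := isomorphic_iff.1 hM
  have hl' : ∀ v, M.l v = G.l (fV.symm v) := fun v => by rw [hl, Equiv.apply_symm_apply]
  have hp' : ∀ v, M.p v = G.p (fV.symm v) := fun v => by rw [hp, Equiv.apply_symm_apply]
  refine ⟨fV r, fun v => ?_, fun v => ?_, ?_, fun v => ?_, fun v hv => ?_⟩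
  · rw [hl']; exact h.lab _
  · rw [hp']; exact h.rooted _
  · rw [← hl, h.l_root]
  · rw [hp', h.p_iff, Equiv.symm_apply_eq]
  · rw [hl'] at hv
    have : Relation.ReflTransGen M.Arc (fV (fV.symm v)) (fV r) :=
      (h.reach _ hv).lift fV (by
        rintro a b ⟨e, rfl, rfl⟩
        exact ⟨fE e, (hs e).symm, (ht e).symm⟩)
    rwa [Equiv.apply_symm_apply] at this

theorem prune (h : WellRooted G r) {e : G.E} (he : Prunable G e) (F : PruneResult G e M) :
    ∃ r', WellRooted M r' := by
  classical
  have hV : ∀ v, v ≠ G.tgt e → ∃ x, F.fV x = v := fun v hv =>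
    (Set.ext_iff.1 F.rangeV v).2 hv
  have ht : ∀ x, F.fV x ≠ G.tgt e := fun x => (Set.ext_iff.1 F.rangeV _).1 ⟨x, rfl⟩
  have hr : G.tgt e = r := (h.p_iff _).1 he.p_tgt
  obtain ⟨u, hu⟩ := hV _ he.src_ne_tgt
  have hl : ∀ v, v ≠ u → M.l v = G.l (F.fV v) := fun v hv => by
    rw [F.l_eq, update_of_ne fun h => hv (F.injV (h.trans hu.symm))]
  have hp : ∀ v, v ≠ u → M.p v = G.p (F.fV v) := fun v hv => by
    rw [F.p_eq, update_of_ne fun h => hv (F.injV (h.trans hu.symm))]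
  have hlu : M.l u = some .box := by rw [F.l_eq, hu, update_self]
  have hpu : M.p u = some true := by rw [F.p_eq, hu, update_self]
  refine ⟨u, fun v => ?_, fun v => ?_, hlu, fun v => ?_, fun v hv => ?_⟩
  · by_cases hv : v = u
    · exact ⟨_, hv ▸ hlu⟩
    · rw [hl v hv]; exact h.lab _
  · by_cases hv : v = u
    · exact ⟨_, hv ▸ hpu⟩
    · rw [hp v hv]; exact h.rooted _
  · by_cases hv : v = u
    · exact iff_of_true (hv ▸ hpu) hv
    · rw [hp v hv, h.p_iff, ← hr]
      exact iff_of_false (ht v) hv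
  · have hvu : v ≠ u := fun h => by rw [h, hlu] at hv; cases hv
    rw [hl v hvu] at hv
    -- A path to the old root must use `e`, since no surviving edge ends there. Cut off before `e`,
    -- it ends at the source of `e`, the new root.
    have key : ∀ a, Relation.ReflTransGen G.Arc a r → ∀ x, F.fV x = a →
        Relation.ReflTransGen M.Arc x u := by
      intro a ha
      induction ha using Relation.ReflTransGen.head_induction_on with
      | refl => exact fun x hx => absurd (hx.trans hr.symm) (ht x)
      | head hab _ ih =>
        obtain ⟨e', rfl, rfl⟩ := hab
        intro x hx
        by_cases he' : e' = e
        · subst he'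
          rw [F.injV (hx.trans hu.symm)]
        · obtain ⟨y, rfl⟩ := (Set.ext_iff.1 F.rangeE e').2 he'
          refine .head ⟨y, ?_, rfl⟩ (ih (M.tgt y) (F.tgt_eq y))
          exact F.injV ((F.src_eq y).trans hx.symm)
    exact key _ (h.reach _ hv) v rfl

theorem descend (h : WellRooted G r) {e : G.E} (he : Descendable G e) (F : DescendResult G e M) :
    ∃ r', WellRooted M r' := by
  classical
  have hV := Set.range_eq_univ.1 F.rangeV
  have hr : G.src e = r := (h.p_iff _).1 he.p_src
  obtain ⟨u, hu⟩ := hV (G.src e)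
  obtain ⟨w, hw⟩ := hV (G.tgt e)
  have huw : u ≠ w := fun h => he.src_ne_tgt (hu.symm.trans ((congrArg F.fV h).trans hw))
  have hlu : M.l u = some .tri := by rw [F.l_eq, hu, update_self]
  have hpw : M.p w = some true := by rw [F.p_eq, hw, update_self]
  have hpu : M.p u = some false := by
    rw [F.p_eq, hu, update_of_ne he.src_ne_tgt, update_self]
  have hl : ∀ v, v ≠ u → M.l v = G.l (F.fV v) := fun v hv => by
    rw [F.l_eq, update_of_ne fun h => hv (F.injV (h.trans hu.symm))]
  have hp : ∀ v, v ≠ u → v ≠ w → M.p v = G.p (F.fV v) := fun v hv hv' => by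
    rw [F.p_eq, update_of_ne fun h => hv' (F.injV (h.trans hw.symm)),
      update_of_ne fun h => hv (F.injV (h.trans hu.symm))]
  -- Edges are unchanged, so a path to the old root is prolonged by `e` to the new one. The only new
  -- `△`-node is the old root itself.
  have hreach : ∀ a, Relation.ReflTransGen G.Arc a r → ∀ x, F.fV x = a →
      Relation.ReflTransGen M.Arc x w := by
    intro a ha
    have harc : ∀ y z, G.Arc (F.fV y) (F.fV z) → M.Arc y z := by
      rintro y z ⟨e', h1, h2⟩
      obtain ⟨e', rfl⟩ := Set.range_eq_univ.1 F.rangeE e'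
      exact ⟨e', F.injV ((F.src_eq _).trans h1), F.injV ((F.tgt_eq _).trans h2)⟩
    induction ha using Relation.ReflTransGen.head_induction_on with
    | refl =>
      intro x hx
      refine .single (harc _ _ ⟨e, ?_, hw.symm⟩)
      rw [hx, hr]
    | @head b c hab _ ih =>
      rintro x rfl
      obtain ⟨y, rfl⟩ := hV c
      exact .head (harc _ _ hab) (ih y rfl)
  refine ⟨w, fun v => ?_, fun v => ?_, ?_, fun v => ?_, fun v hv => ?_⟩
  · by_cases hv : v = u
    · exact ⟨_, hv ▸ hlu⟩
    · rw [hl v hv]; exact h.lab _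
  · by_cases hv : v = u
    · exact ⟨_, hv ▸ hpu⟩
    · by_cases hv' : v = w
      · exact ⟨_, hv' ▸ hpw⟩
      · rw [hp v hv hv']; exact h.rooted _
  · rw [hl w huw.symm, hw, he.l_tgt]
  · by_cases hv : v = u
    · subst hv
      simp [hpu, huw]
    · by_cases hv' : v = w
      · exact iff_of_true (hv' ▸ hpw) hv'
      · rw [hp v hv hv', h.p_iff, ← hr]
        exact iff_of_false (fun h => hv (F.injV (h.trans hu.symm))) hv'
  · by_cases hvu : v = u
    · exact hreach r .refl v (by rw [hvu, hu, hr])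
    · rw [hl v hvu] at hv
      exact hreach _ (h.reach _ hv) v rfl

theorem isomorphic_singleRoot (h : WellRooted G r) (hn : InNormalForm treeRules G)
    (ht : (unlabel G).IsTree) : Isomorphic G singleRoot := by
  rw [inNormalForm_treeRules_iff] at hn
  have hcyc : ∀ e : G.E, ¬ Relation.ReflTransGen G.Arc (G.tgt e) (G.src e) :=
    fun e => ht.not_reach_src e
  have hloop : ∀ e : G.E, G.tgt e ≠ G.src e := fun e he => hcyc e (he ▸ .refl)
  have hsrc : ∀ e, G.src e ≠ r := by
    rintro e rfl
    obtain ⟨a, ha⟩ := h.lab (G.tgt e)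
    cases a
    · exact (hn e).2 ⟨h.l_root, (h.p_iff _).2 rfl, ha, h.p_false (hloop e)⟩
    -- A `△`-child would reach the root and close a directed cycle.
    · exact hcyc e (h.reach _ ha)
  have htgt : ∀ e, G.tgt e ≠ r := by
    rintro e rfl
    exact (hn e).1 ⟨h.l_root, (h.p_iff _).2 rfl, h.lab _, h.p_false (hsrc e),
      -- No edge leaves the root, and by the indegree condition only `e` enters it, so `e` is
      -- prunable.
      fun x hx => ⟨hsrc x, fun hx' =>
        hx (indeg_le_one_iff.1 (ht.2.2.2 (G.tgt e)) x e hx' rfl)⟩⟩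
  have hV : ∀ v, v = r := by
    intro v
    obtain ⟨es, hw⟩ := ht.2.1 r v
    generalize hb : (show (unlabel G).V from r) = b at hw
    cases hw with
    | nil => rw [← hb]
    | fwd e _ => exact absurd hb.symm (hsrc e)
    | bwd e _ => exact absurd hb.symm (htgt e)
  have hE : IsEmpty G.E := ⟨fun e => hsrc e (hV _)⟩
  refine isomorphic_iff.2 ⟨⟨fun _ => (0 : Fin 1), fun _ => r, fun v => (hV v).symm,
    fun v => Subsingleton.elim (α := Fin 1) _ _⟩, ⟨fun e => (hE.false e).elim, fun e => e.elim,
    fun e => (hE.false e).elim, fun e => e.elim⟩, fun e => (hE.false e).elim,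
    fun e => (hE.false e).elim, fun e => (hE.false e).elim, fun v => ?_, fun v => ?_⟩
  · rw [hV v, h.l_root]; rfl
  · rw [hV v, (h.p_iff r).2 rfl]; rfl

end WellRooted

theorem DerivesIn.exists_wellRooted {n : ℕ} {G H : LGraph Mark Box}
    (h : DerivesIn treeRules n G H) (hG : IsInputGraph G) : ∃ r, WellRooted H r := by
  induction n generalizing H with
  | zero =>
    obtain ⟨r, hr⟩ := hG.wellRooted
    exact hr.of_isomorphic h
  | succ n ih =>
    obtain ⟨M, hM, h⟩ := h
    obtain ⟨r, hr⟩ := ih hM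
    obtain ⟨e, ⟨h, ⟨F⟩⟩ | ⟨h, ⟨F⟩⟩⟩ := directDerivation_treeRules_iff.1 h
    · exact hr.prune h F
    · exact hr.descend h F

theorem isNormalFormOf_iff {G H : LGraph Mark Box} (hG : IsInputGraph G)
    (h : IsNormalFormOf treeRules H G) :
    (Isomorphic H singleRoot ↔ (unlabel G).cls ∈ TREE.language) ∧
      (Isomorphic H singleRoot ↔ (unlabel G).IsTree) := by
  obtain ⟨⟨n, hn⟩, hH⟩ := h
  have hab : Isomorphic H singleRoot → (unlabel G).cls ∈ TREE.language := fun hiso =>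
    mem_language_TREE_iff.2 (hn.derives_unlabel ⟨0, (isomorphic_unlabel hiso).symm⟩)
  have hbc : (unlabel G).cls ∈ TREE.language → (unlabel G).IsTree := fun h =>
    (mem_language_TREE_iff.1 h).isTree.2
  have hca : (unlabel G).IsTree → Isomorphic H singleRoot := fun h => by
    obtain ⟨r, hr⟩ := hn.exists_wellRooted hG
    exact hr.isomorphic_singleRoot hH (hn.isTree_unlabel h)
  exact ⟨⟨hab, fun h => hca (hbc h)⟩, ⟨fun h => hbc (hab h), hca⟩⟩

/-! ## Updates of stored graphs -/

namespace Store

/-- Move the root from `r` to `t` and relabel `r`. -/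
def descend (S : Store Mark Box) (r t : ℕ) : Store Mark Box :=
  ((S.setLab r .tri).setRoot r false).setRoot t true

/-- Delete an isolated node. -/
def eraseNode (S : Store Mark Box) (v : ℕ) (h : ∀ e ∈ S.E, S.src e ≠ v ∧ S.tgt e ≠ v) :
    Store Mark Box :=
  { S with
    V := S.V.erase v
    src_mem := fun e he => Finset.mem_erase.2 ⟨(h e he).1, S.src_mem e he⟩
    tgt_mem := fun e he => Finset.mem_erase.2 ⟨(h e he).2, S.tgt_mem e he⟩ }

theorem delNode_eq (S : Store Mark Box) (v : ℕ) (h : ∀ e ∈ S.E, S.src e ≠ v ∧ S.tgt e ≠ v) :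
    S.delNode v = some (S.eraseNode v h) := dif_pos h

variable {S : Store Mark Box} {e r t : ℕ}

open Classical in
theorem update_l {u : S.toGraph.V} {a : Mark} :
    update S.toGraph.l u (some a) = (S.setLab u.1 a).toGraph.l := by
  funext v
  change _ = some (update S.lab u.1 a v.1)
  by_cases h : v = u
  · rw [h, update_self, update_self]
  · rw [update_of_ne h, update_of_ne fun h' => h (Subtype.ext h')]; rfl

open Classical in
theorem update_p {u : S.toGraph.V} {b : Bool} :
    update S.toGraph.p u (some b) = (S.setRoot u.1 b).toGraph.p := by
  funext v
  change _ = some (update S.root u.1 b v.1)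
  by_cases h : v = u
  · rw [h, update_self, update_self]
  · rw [update_of_ne h, update_of_ne fun h' => h (Subtype.ext h')]; rfl

theorem descendResult (he : e ∈ S.E) :
    Nonempty (DescendResult S.toGraph ⟨e, he⟩ (S.descend (S.src e) (S.tgt e)).toGraph) := by
  classical
  refine ⟨{
    fV := fun v => v
    fE := fun e => e
    injV := fun _ _ h => h
    injE := fun _ _ h => h
    src_eq := fun _ => rfl
    tgt_eq := fun _ => rfl
    m_eq := fun _ => rfl
    l_eq := fun v => ?_
    p_eq := fun v => ?_
    rangeV := Set.range_id
    rangeE := Set.range_id }⟩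
  · exact (congrFun (update_l (u := ⟨S.src e, S.src_mem e he⟩)) v).symm
  · rw [update_p]
    exact (congrFun (update_p (S := S.setRoot (S.src e) false)
      (u := ⟨S.tgt e, S.tgt_mem e he⟩)) v).symm

/-- Delete the edge `e` and its target `r`, and make its source a root labelled `□`. -/
def prune (S : Store Mark Box) (e r : ℕ)
    (h : ∀ x ∈ (S.delEdge e).E, S.src x ≠ r ∧ S.tgt x ≠ r) : Store Mark Box :=
  (((S.delEdge e).eraseNode r h).setLab (S.src e) .box).setRoot (S.src e) true

theorem pruneResult (he : e ∈ S.E) (hr : S.tgt e = r)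
    (h : ∀ x ∈ (S.delEdge e).E, S.src x ≠ r ∧ S.tgt x ≠ r) :
    Nonempty (PruneResult S.toGraph ⟨e, he⟩ (S.prune e r h).toGraph) := by
  classical
  subst hr
  refine ⟨{
    fV := fun v => ⟨v.1, Finset.mem_of_mem_erase v.2⟩
    fE := fun e => ⟨e.1, Finset.mem_of_mem_erase e.2⟩
    injV := fun _ _ h => by
      have h := congrArg Subtype.val h
      exact Subtype.ext h
    injE := fun _ _ h => by
      have h := congrArg Subtype.val h
      exact Subtype.ext h
    src_eq := fun _ => rfl
    tgt_eq := fun _ => rfl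
    m_eq := fun _ => rfl
    l_eq := fun v => ?_
    p_eq := fun v => ?_
    rangeV := ?_
    rangeE := ?_ }⟩
  · exact (congrFun (update_l (u := ⟨S.src e, S.src_mem e he⟩)) ⟨v.1, _⟩).symm
  · exact (congrFun (update_p (u := ⟨S.src e, S.src_mem e he⟩)) ⟨v.1, _⟩).symm
  · ext v
    constructor
    · rintro ⟨x, rfl⟩ h
      exact Finset.ne_of_mem_erase x.2 (congrArg Subtype.val h)
    · exact fun h => ⟨⟨v.1, Finset.mem_erase.2 ⟨fun h' => h (Subtype.ext h'), v.2⟩⟩, rfl⟩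
  · ext v
    constructor
    · rintro ⟨x, rfl⟩ h
      exact Finset.ne_of_mem_erase x.2 (congrArg Subtype.val h)
    · exact fun h => ⟨⟨v.1, Finset.mem_erase.2 ⟨fun h' => h (Subtype.ext h'), v.2⟩⟩, rfl⟩

/-! ### Applicability of rules, read off the stored graph -/

theorem mem_outSet {v : ℕ} : e ∈ S.outSet v ↔ e ∈ S.E ∧ S.src e = v := Finset.mem_filter

theorem mem_inSet {v : ℕ} : e ∈ S.inSet v ↔ e ∈ S.E ∧ S.tgt e = v := Finset.mem_filter

theorem outSet_prune_subset (h : ∀ x ∈ (S.delEdge e).E, S.src x ≠ r ∧ S.tgt x ≠ r) (v : ℕ) :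
    (S.prune e r h).outSet v ⊆ S.outSet v :=
  Finset.filter_subset_filter _ (Finset.erase_subset _ _)

/-- The stored graph has exactly one root, which is the node `r` and is labelled `□`. -/
structure HasRoot (S : Store Mark Box) (r : ℕ) : Prop where
  mem : r ∈ S.V
  lab_root : S.lab r = .box
  root_iff : ∀ v ∈ S.V, S.root v = true ↔ v = r

theorem exists_hasRoot {x : S.toGraph.V} (h : WellRooted S.toGraph x) : S.HasRoot x.1 :=
  ⟨x.2, Option.some_injective _ h.l_root, fun v hv =>
    ⟨fun hr => congrArg Subtype.val ((h.p_iff ⟨v, hv⟩).1 (congrArg some hr)),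
      fun hr => Option.some_injective _ ((h.p_iff ⟨v, hv⟩).2 (Subtype.ext hr))⟩⟩

theorem HasRoot.nodeSet_box (h : S.HasRoot r) : S.nodeSet .box true = {r} := by
  ext v
  rw [nodeSet, Finset.mem_filter, Finset.mem_singleton]
  constructor
  · exact fun hv => (h.root_iff v hv.1).1 hv.2.2
  · rintro rfl
    exact ⟨h.mem, h.lab_root, (h.root_iff _ h.mem).2 rfl⟩

/-- This query lets the program initialize its termination flag to the empty list. -/
theorem HasRoot.nodeSet_tri (h : S.HasRoot r) : S.nodeSet .tri true = ∅ := by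
  refine Finset.filter_eq_empty_iff.2 fun v hv hv' => ?_
  rw [(h.root_iff v hv).1 hv'.2, h.lab_root] at hv'
  cases hv'.1

theorem HasRoot.descendable (h : S.HasRoot r) (he : e ∈ S.E) (hs : S.src e = r)
    (hl : S.lab (S.tgt e) = .box) (hp : S.root (S.tgt e) = false) :
    Descendable S.toGraph ⟨e, he⟩ := by
  subst hs
  exact ⟨congrArg some h.lab_root, congrArg some ((h.root_iff _ h.mem).2 rfl),
    congrArg some hl, congrArg some hp⟩

theorem HasRoot.prunable (h : S.HasRoot r) (he : e ∈ S.E) (hout : (S.outSet r).card = 0)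
    (hin : S.inSet r = {e}) : Prunable S.toGraph ⟨e, he⟩ := by
  have hs : ∀ x ∈ S.E, S.src x ≠ r := fun x hx hr => by
    have := mem_outSet.2 ⟨hx, hr⟩
    rw [Finset.card_eq_zero.1 hout] at this
    simp at this
  have ht : S.tgt e = r := (mem_inSet.1 (by rw [hin]; simp : e ∈ S.inSet r)).2
  subst ht
  refine ⟨congrArg some h.lab_root, congrArg some ((h.root_iff _ h.mem).2 rfl), ⟨_, rfl⟩,
    congrArg some ?_, fun x hx => ⟨fun hx' => hs x.1 x.2 (congrArg Subtype.val hx'), fun hx' => hx ?_⟩⟩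
  · rw [← Bool.not_eq_true]
    exact fun hr => hs e he ((h.root_iff _ (S.src_mem e he)).1 hr)
  · have : x.1 ∈ S.inSet (S.tgt e) := mem_inSet.2 ⟨x.2, congrArg Subtype.val hx'⟩
    rw [hin, Finset.mem_singleton] at this
    exact Subtype.ext this

/-- A descendable edge leaves the unique root, and a prunable edge is the only one incident to it.
So inspecting the outgoing edges and two degrees suffices. -/
theorem HasRoot.inNormalForm (h : S.HasRoot r)
    (hd : ∀ e ∈ S.outSet r, S.lab (S.tgt e) = .box → S.root (S.tgt e) ≠ false)
    (hp : (S.outSet r).card = 0 → (S.inSet r).card ≠ 1) : InNormalForm treeRules S.toGraph := by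
  rw [inNormalForm_treeRules_iff]
  rintro ⟨e, he⟩
  constructor
  · intro hpr
    have ht : S.tgt e = r := (h.root_iff _ (S.tgt_mem e he)).1 (Option.some_injective _ hpr.p_tgt)
    have hst : S.src e ≠ S.tgt e := fun h' => hpr.src_ne_tgt (Subtype.ext h')
    refine hp ?_ ?_
    · rw [Finset.card_eq_zero, Finset.eq_empty_iff_forall_notMem]
      intro x hx
      obtain ⟨hx, hxr⟩ := mem_outSet.1 hx
      by_cases hxe : x = e
      · exact hst (by rw [ht, ← hxr, hxe])
      · exact (hpr.isolated ⟨x, hx⟩ fun h => hxe (congrArg Subtype.val h)).1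
          (Subtype.ext (hxr.trans ht.symm))
    · rw [Finset.card_eq_one]
      refine ⟨e, Finset.eq_singleton_iff_unique_mem.2 ⟨mem_inSet.2 ⟨he, ht⟩, fun x hx => ?_⟩⟩
      obtain ⟨hx, hxr⟩ := mem_inSet.1 hx
      by_contra hxe
      exact (hpr.isolated ⟨x, hx⟩ fun h => hxe (congrArg Subtype.val h)).2
          (Subtype.ext (hxr.trans ht.symm))
  · intro hde
    exact hd e (mem_outSet.2 ⟨he, (h.root_iff _ (S.src_mem e he)).1
      (Option.some_injective _ hde.p_src)⟩) (Option.some_injective _ hde.l_tgt)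
      (Option.some_injective _ hde.p_tgt)

end Store

theorem Enumeration.length_list (ord : Enumeration) (t : ℕ) (X : Finset ℕ) :
    (ord.list t X).length = X.card := by
  rw [← List.toFinset_card_of_nodup (ord.nodup t X)]
  congr 1
  ext x
  rw [List.mem_toFinset, ord.mem_iff]

theorem Enumeration.list_empty (ord : Enumeration) (t : ℕ) : ord.list t ∅ = [] :=
  List.length_eq_zero_iff.1 (ord.length_list t ∅)

theorem Enumeration.list_singleton (ord : Enumeration) (t x : ℕ) : ord.list t {x} = [x] := by
  obtain ⟨y, hy⟩ := List.length_eq_one_iff.1 (ord.length_list t {x})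
  have := (ord.mem_iff t {x} y).1 (by rw [hy]; simp)
  rw [hy, Finset.mem_singleton.1 this]

/-! ## The program

Node register `0` holds the root, edge list `0` the outgoing edges of the root that have not been
inspected, and node list `1` is non-empty once a normal form has been found. -/

/-- Move the root to the node in register `1`. -/
def visitProg : Prog Mark Box :=
  .seq (.op (.setLab 0 .tri)) (.seq (.op (.setRoot 0 false)) (.seq (.op (.copyNode 1 0))
    (.seq (.op (.setRoot 0 true)) (.op (.outEdges 0 0)))))

/-- Inspect an outgoing edge of the root. -/
def scanProg : Prog Mark Box :=
  .seq (.op (.popEdge 0 0)) (.seq (.op (.tgtOf 0 1))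
    (.ite (.nodeLab 1 .box) (.ite (.rooted 1) .skip visitProg) .skip))

/-- Delete the root and its only incident edge, and move the root to its parent. -/
def pruneProg : Prog Mark Box :=
  .seq (.op (.inEdges 0 0)) (.seq (.op (.popEdge 0 0)) (.seq (.op (.srcOf 0 1))
    (.seq (.op (.delEdge 0)) (.seq (.op (.delNode 0)) (.seq (.op (.copyNode 1 0))
      (.seq (.op (.setLab 0 .box)) (.seq (.op (.setRoot 0 true)) (.op (.outEdges 0 0)))))))))

/-- The body of the main loop. -/
def bodyProg : Prog Mark Box :=
  .ite (.elistEmpty 0)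
    (.ite (.outdegEq 0 0) (.ite (.indegEq 0 1) pruneProg (.op (.rootedNodes .box 1)))
      (.op (.rootedNodes .box 1)))
    scanProg

/-- The main loop. -/
def loopProg : Prog Mark Box := .while (.nlistEmpty 1) bodyProg

/-- A program that finds a normal form with respect to the tree recognition system. -/
def normalizeProg : Prog Mark Box :=
  .seq (.op (.rootedNodes .box 0)) (.seq (.op (.popNode 0 0)) (.seq (.op (.outEdges 0 0))
    (.seq (.op (.rootedNodes .tri 1)) loopProg)))

/-! ### Effect and cost of the program's pieces -/

section Execution

variable {ord : Enumeration} {s : State Mark Box}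

theorem exec_popEdge {i j x : ℕ} {xs : List ℕ} (h : s.elist j = x :: xs) :
    Exec ord (.op (.popEdge j i)) s { s with
      ereg := update s.ereg i x
      elist := update s.elist j xs
      time := s.time + 1 } := by
  refine .op ?_
  simp only [Op.eval]
  rw [h]

theorem exec_popNode {i j x : ℕ} {xs : List ℕ} (h : s.nlist j = x :: xs) :
    Exec ord (.op (.popNode j i)) s { s with
      nreg := update s.nreg i x
      nlist := update s.nlist j xs
      time := s.time + 1 } := by
  refine .op ?_
  simp only [Op.eval]
  rw [h]

theorem exec_delNode {i : ℕ} {S : Store Mark Box} (h : s.store.delNode (s.nreg i) = some S) :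
    Exec ord (.op (.delNode i)) s { s with store := S, time := s.time + 1 } := by
  refine .op ?_
  simp only [Op.eval]
  rw [h, Option.map_some]

theorem exec_visitProg : ∃ s', Exec ord visitProg s s' ∧
    s'.store = s.store.descend (s.nreg 0) (s.nreg 1) ∧ s'.nreg 0 = s.nreg 1 ∧
    s'.nlist = s.nlist ∧ (∃ t, s'.elist 0 = ord.list t (s'.store.outSet (s.nreg 1))) ∧
    s'.time = s.time + ((s'.store.outSet (s.nreg 1)).card + 5) := by
  refine ⟨_, .seq (.op rfl) (.seq (.op rfl) (.seq (.op rfl) (.seq (.op rfl) (.op rfl)))),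
    ?_, ?_, ?_, ?_, ?_⟩
  · simp [Store.descend]
  · simp
  · rfl
  · simp only [update_self]
    exact ⟨_, rfl⟩
  -- Four unit operations and one query of cost `card + 1`.
  · simp only [update_self]
    omega

theorem exec_pruneProg {e : ℕ} (hin : s.store.inSet (s.nreg 0) = {e})
    (h : ∀ x ∈ (s.store.delEdge e).E, s.store.src x ≠ s.nreg 0 ∧ s.store.tgt x ≠ s.nreg 0) :
    ∃ s', Exec ord pruneProg s s' ∧
      s'.store = s.store.prune e (s.nreg 0) h ∧ s'.nreg 0 = s.store.src e ∧
      s'.nlist = s.nlist ∧ (∃ t, s'.elist 0 = ord.list t (s'.store.outSet (s.store.src e))) ∧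
      s'.time = s.time + ((s'.store.outSet (s.store.src e)).card + 10) := by
  refine ⟨_, .seq (.op rfl) (.seq (exec_popEdge (x := e) (xs := []) ?_) (.seq (.op rfl)
    (.seq (.op rfl) (.seq (exec_delNode (S := (s.store.delEdge e).eraseNode (s.nreg 0) h) ?_)
      (.seq (.op rfl) (.seq (.op rfl) (.seq (.op rfl) (.op rfl)))))))),
    ?_, ?_, ?_, ?_, ?_⟩
  · simp only [update_self]
    rw [hin, ord.list_singleton]
  · simp only [update_self]
    exact Store.delNode_eq _ _ h
  · simp [Store.prune]
  · simp
  · rfl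
  · simp only [update_self]
    exact ⟨_, rfl⟩
  -- The query for the single incoming edge costs `2`, seven unit operations follow, and the last
  -- query costs `card + 1`.
  · simp only [update_self, hin, Finset.card_singleton]
    omega

end Execution

/-! ### Loop invariant and running time -/

/-- The invariant of the main loop. -/
structure LoopInv (G : LGraph Mark Box) (b : ℕ) (s : State Mark Box) : Prop where
  derives : Derives treeRules G s.store.toGraph
  hasRoot : s.store.HasRoot (s.nreg 0)
  card_le : ∀ v, (s.store.outSet v).card ≤ b
  list_mem : ∀ e ∈ s.elist 0, e ∈ s.store.outSet (s.nreg 0)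
  checked : ∀ e ∈ s.store.outSet (s.nreg 0), e ∉ s.elist 0 →
    s.store.lab (s.store.tgt e) = .box → s.store.root (s.store.tgt e) ≠ false
  flag : s.nlist 1 = []

/-- A bound for the time that the main loop takes. -/
noncomputable def potential (b : ℕ) (s : State Mark Box) : ℕ :=
  (7 * b + 20) * weight s.store.toGraph + 6 * (s.elist 0).length + 10

/-- Uniqueness and the label of the root come from `WellRooted`; after a step it remains only to
exhibit some rooted node. -/
theorem Derives.hasRoot {G : LGraph Mark Box} (hG : IsInputGraph G) {S : Store Mark Box} {r : ℕ}
    (h : Derives treeRules G S.toGraph) (hr : r ∈ S.V) (hp : S.root r = true) : S.HasRoot r := by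
  obtain ⟨n, hn⟩ := h
  obtain ⟨x, hx⟩ := hn.exists_wellRooted hG
  have := Store.exists_hasRoot hx
  rwa [(this.root_iff r hr).1 hp]

/-- The invariant after a derivation step, when the outgoing edges of the new root have been
listed. -/
theorem LoopInv.next {G : LGraph Mark Box} {b : ℕ} {s s' : State Mark Box} {ord : Enumeration}
    (hG : IsInputGraph G) (h : LoopInv G b s)
    (hd : DirectDerivation treeRules s.store.toGraph s'.store.toGraph)
    (hmem : s'.nreg 0 ∈ s'.store.V) (hroot : s'.store.root (s'.nreg 0) = true)
    (hout : ∀ v, s'.store.outSet v ⊆ s.store.outSet v) (hflag : s'.nlist = s.nlist)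
    (hlist : ∃ t, s'.elist 0 = ord.list t (s'.store.outSet (s'.nreg 0))) :
    LoopInv G b s' ∧ potential b s' + (b + 20) ≤ potential b s := by
  obtain ⟨n, hn⟩ := h.derives
  obtain ⟨t, ht⟩ := hlist
  have hder : Derives treeRules G s'.store.toGraph := ⟨n + 1, _, hn, hd⟩
  have hc : ∀ v, (s'.store.outSet v).card ≤ b := fun v =>
    (Finset.card_le_card (hout v)).trans (h.card_le v)
  refine ⟨⟨hder, hder.hasRoot hG hmem hroot, hc, fun e he => ?_, fun e he he' => ?_, ?_⟩, ?_⟩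
  · rwa [ht, ord.mem_iff] at he
  · rw [ht, ord.mem_iff] at he'
    exact absurd he he'
  · rw [hflag, h.flag]
  · have h1 : (s'.elist 0).length ≤ b := by
      rw [ht, ord.length_list]; exact hc _
    -- The weight drops by at least one, which frees `7 * b + 20`. The new list takes up at most `6
    -- * b` of it, and `b + 20` remains for the time of the pass.
    have h2 := Nat.mul_le_mul_left (7 * b + 20) (Nat.succ_le_of_lt hd.weight_lt)
    rw [Nat.succ_eq_add_one, mul_add, mul_one] at h2
    unfold potential
    omega

/-- The drop in potential pays for the pass, including the loop test. Rejecting an edge costs at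
most the `6` units its list entry carries; a rule application costs at most `b + 14`; halting is
covered by the constant `10`. -/
theorem LoopInv.exec_body {G : LGraph Mark Box} (hG : IsInputGraph G) {b : ℕ} (ord : Enumeration)
    {s : State Mark Box} (h : LoopInv G b s) : ∃ s', Exec ord bodyProg s.tick s' ∧
      ((LoopInv G b s' ∧ s'.time + potential b s' ≤ s.time + potential b s ∧
          potential b s' < potential b s) ∨
        (s'.nlist 1 ≠ [] ∧ s'.time + 1 ≤ s.time + potential b s ∧
          IsNormalFormOf treeRules s'.store.toGraph G)) := by
  -- At most four tests come first; raising the flag costs `2`, and the extra `1` is reserved for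
  -- the final loop test.
  have halt : ∀ k ≤ 4, InNormalForm treeRules s.store.toGraph →
      ∃ s', Exec ord (.op (.rootedNodes .box 1)) { s with time := s.time + k } s' ∧
        s'.nlist 1 ≠ [] ∧ s'.time + 1 ≤ s.time + potential b s ∧
          IsNormalFormOf treeRules s'.store.toGraph G := by
    intro k hk hn
    refine ⟨_, .op rfl, ?_, ?_, h.derives, hn⟩
    · simp only [update_self, h.hasRoot.nodeSet_box, ord.list_singleton]
      exact List.cons_ne_nil _ _
    · simp only [h.hasRoot.nodeSet_box, Finset.card_singleton]
      unfold potential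
      omega
  cases hL : s.elist 0 with
  | nil =>
    have hchecked := fun e he => h.checked e he (by rw [hL]; exact List.not_mem_nil)
    have t0 : Test.eval s.tick (.elistEmpty 0 : Test Mark Box) = true := by
      simp [Test.eval, State.tick, hL]
    by_cases hout : (s.store.outSet (s.nreg 0)).card = 0
    · have t1 : Test.eval s.tick.tick (.outdegEq 0 0 : Test Mark Box) = true :=
        decide_eq_true hout
      by_cases hin : (s.store.inSet (s.nreg 0)).card = 1
      · have t2 : Test.eval s.tick.tick.tick (.indegEq 0 1 : Test Mark Box) = true :=
          decide_eq_true hin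
        obtain ⟨e, he⟩ := Finset.card_eq_one.1 hin
        obtain ⟨heE, het⟩ := Store.mem_inSet.1 (by rw [he]; simp : e ∈ s.store.inSet (s.nreg 0))
        have hpr := h.hasRoot.prunable heE hout he
        have hiso : ∀ x ∈ (s.store.delEdge e).E,
            s.store.src x ≠ s.nreg 0 ∧ s.store.tgt x ≠ s.nreg 0 := by
          intro x hx
          obtain ⟨hxe, hx⟩ := Finset.mem_erase.1 hx
          have := hpr.isolated ⟨x, hx⟩ fun h => hxe (congrArg Subtype.val h)
          rw [← het]
          exact ⟨fun h => this.1 (Subtype.ext h), fun h => this.2 (Subtype.ext h)⟩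
        obtain ⟨s', hs', hst, hreg, hnl, hel, htime⟩ :=
          exec_pruneProg (ord := ord) (s := s.tick.tick.tick.tick) he hiso
        have hd : DirectDerivation treeRules s.store.toGraph s'.store.toGraph := by
          refine directDerivation_treeRules_iff.2 ⟨⟨e, heE⟩, Or.inl ⟨hpr, ?_⟩⟩
          rw [hst]
          exact Store.pruneResult heE het hiso
        have hsrc : s.store.src e ≠ s.nreg 0 := by
          rw [← het]
          exact fun h => hpr.src_ne_tgt (Subtype.ext h)
        have hmem : s'.nreg 0 ∈ s'.store.V := by
          rw [hreg, hst]
          exact Finset.mem_erase.2 ⟨hsrc, s.store.src_mem e heE⟩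
        have hroot : s'.store.root (s'.nreg 0) = true := by
          rw [hreg, hst]
          exact update_self (β := fun _ => Bool) _ _ _
        have hsub : ∀ v, s'.store.outSet v ⊆ s.store.outSet v := by
          rw [hst]; exact Store.outSet_prune_subset hiso
        obtain ⟨hinv, hpot⟩ := h.next hG hd hmem hroot hsub hnl (by rw [hreg]; exact hel)
        refine ⟨s', .iteTrue t0 (.iteTrue t1 (.iteTrue t2 hs')), Or.inl ⟨hinv, ?_, by omega⟩⟩
        have := hinv.card_le (s.store.src e)
        have : s.tick.tick.tick.tick.time = s.time + 4 := rfl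
        have : s.tick.tick.tick.tick.store = s.store := rfl
        rw [this] at htime
        omega
      · have t2 : Test.eval s.tick.tick.tick (.indegEq 0 1 : Test Mark Box) = false :=
          decide_eq_false hin
        obtain ⟨s', hs', hh⟩ := halt 4 le_rfl (h.hasRoot.inNormalForm hchecked fun _ => hin)
        exact ⟨s', .iteTrue t0 (.iteTrue t1 (.iteFalse t2 hs')), Or.inr hh⟩
    · have t1 : Test.eval s.tick.tick (.outdegEq 0 0 : Test Mark Box) = false :=
        decide_eq_false hout
      obtain ⟨s', hs', hh⟩ := halt 3 (by omega)
        (h.hasRoot.inNormalForm hchecked fun h' => absurd h' hout)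
      exact ⟨s', .iteTrue t0 (.iteFalse t1 hs'), Or.inr hh⟩
  | cons e L =>
    have t0 : Test.eval s.tick (.elistEmpty 0 : Test Mark Box) = false := by
      simp [Test.eval, State.tick, hL]
    obtain ⟨heE, hes⟩ := Store.mem_outSet.1 (h.list_mem e (by rw [hL]; exact List.mem_cons_self))
    let s1 : State Mark Box := { s with
      ereg := update s.ereg 0 e
      elist := update s.elist 0 L
      nreg := update s.nreg 1 (s.store.tgt e)
      time := s.time + 4 }
    have hpop : ∀ {Q s'}, Exec ord Q s1 s' → Exec ord
        (.seq (.op (.popEdge 0 0)) (.seq (.op (.tgtOf 0 1)) Q)) s.tick.tick s' := by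
      intro Q s' hQ
      refine .seq (exec_popEdge (s := s.tick.tick) hL) (.seq (.op rfl) ?_)
      simpa [s1, State.tick] using hQ
    have hreg0 : s1.nreg 0 = s.nreg 0 := by simp [s1]
    have hreg1 : s1.nreg 1 = s.store.tgt e := by simp [s1]
    have hel : s1.elist 0 = L := by simp [s1]
    -- Rejecting an edge leaves the stored graph alone, so earlier inspections stay valid and only
    -- `e` has to be added to the inspected edges.
    have hskip : ∀ k ≤ 6, (s.store.lab (s.store.tgt e) = .box →
        s.store.root (s.store.tgt e) ≠ false) →
        LoopInv G b { s1 with time := s.time + k } ∧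
          s.time + k + potential b { s1 with time := s.time + k } ≤ s.time + potential b s ∧
          potential b { s1 with time := s.time + k } < potential b s := by
      intro k hk hc
      refine ⟨⟨h.derives, ?_, h.card_le, fun x hx => ?_, fun x hx hx' => ?_, h.flag⟩, ?_⟩
      · rw [hreg0]; exact h.hasRoot
      · rw [hreg0]
        exact h.list_mem x (by rw [hL]; exact List.mem_cons_of_mem _ (hel ▸ hx))
      · rw [hreg0] at hx
        by_cases hxe : x = e
        · rw [hxe]; exact hc
        · refine h.checked x hx ?_
          rw [hL, List.mem_cons, not_or]
          exact ⟨hxe, hel ▸ hx'⟩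
      · simp only [potential, hel, hL, List.length_cons]
        constructor <;> simp only [s1] <;> omega
    by_cases hlab : s.store.lab (s.store.tgt e) = .box
    · have t1 : Test.eval s1 (.nodeLab 1 .box : Test Mark Box) = true := by
        refine decide_eq_true ?_
        rw [hreg1]; exact hlab
      cases hroot : s.store.root (s.store.tgt e) with
      | true =>
        have t2 : Test.eval s1.tick (.rooted 1 : Test Mark Box) = true := hroot
        exact ⟨_, .iteFalse t0 (hpop (.iteTrue t1 (.iteTrue t2 .skip))),
          Or.inl (hskip 6 le_rfl fun _ => by simp [hroot])⟩
      | false =>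
        have t2 : Test.eval s1.tick (.rooted 1 : Test Mark Box) = false := hroot
        obtain ⟨s', hs', hst, hreg, hnl, hel', htime⟩ :=
          exec_visitProg (ord := ord) (s := s1.tick.tick)
        have hst' : s'.store = s.store.descend (s.store.src e) (s.store.tgt e) := by
          rw [hst, hes]
          rfl
        have hreg' : s'.nreg 0 = s.store.tgt e := hreg
        have hd : DirectDerivation treeRules s.store.toGraph s'.store.toGraph := by
          rw [hst']
          exact directDerivation_treeRules_iff.2 ⟨⟨e, heE⟩,
            Or.inr ⟨h.hasRoot.descendable heE hes hlab hroot, Store.descendResult heE⟩⟩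
        have hmem : s'.nreg 0 ∈ s'.store.V := by
          rw [hreg', hst']; exact s.store.tgt_mem e heE
        have hroot' : s'.store.root (s'.nreg 0) = true := by
          rw [hreg', hst']
          exact update_self (β := fun _ => Bool) _ _ _
        have hsub : ∀ v, s'.store.outSet v ⊆ s.store.outSet v := by
          rw [hst']; exact fun v => Finset.Subset.refl _
        obtain ⟨hinv, hpot⟩ := h.next hG hd hmem hroot' hsub hnl (by rw [hreg']; exact hel')
        refine ⟨s', .iteFalse t0 (hpop (.iteTrue t1 (.iteFalse t2 hs'))),
          Or.inl ⟨hinv, ?_, by omega⟩⟩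
        have := hinv.card_le (s1.tick.tick.nreg 1)
        have : s1.tick.tick.time = s.time + 6 := rfl
        omega
    · have t1 : Test.eval s1 (.nodeLab 1 .box : Test Mark Box) = false := by
        refine decide_eq_false ?_
        rw [hreg1]; exact hlab
      exact ⟨_, .iteFalse t0 (hpop (.iteFalse t1 .skip)),
        Or.inl (hskip 5 (by omega) fun h => absurd h hlab)⟩

/-- Induction on a bound for the potential, which is at least `10`; the base case is thus vacuous.
-/
theorem LoopInv.exec_loop {G : LGraph Mark Box} (hG : IsInputGraph G) {b : ℕ} (ord : Enumeration)
    (n : ℕ) {s : State Mark Box} (h : LoopInv G b s) (hn : potential b s ≤ n) :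
    ∃ s', Exec ord loopProg s s' ∧ s'.time ≤ s.time + potential b s ∧
      IsNormalFormOf treeRules s'.store.toGraph G := by
  induction n generalizing s with
  | zero => exact absurd hn (by simp [potential])
  | succ n ih =>
    have t0 : Test.eval s (.nlistEmpty 1 : Test Mark Box) = true := by
      simp [Test.eval, h.flag]
    obtain ⟨s1, hs1, ⟨h1, ht, hlt⟩ | ⟨h1, ht, hnf⟩⟩ := h.exec_body hG ord
    · obtain ⟨s2, hs2, ht2, hnf⟩ := ih h1 (by omega)
      exact ⟨s2, .whileTrue t0 hs1 hs2, by omega, hnf⟩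
    · have t1 : Test.eval s1 (.nlistEmpty 1 : Test Mark Box) = false := by
        simp [Test.eval, h1]
      exact ⟨s1.tick, .whileTrue t0 hs1 (.whileFalse t1), ht, hnf⟩

theorem exec_normalizeProg {G : LGraph Mark Box} (hG : IsInputGraph G) {b : ℕ}
    (hb : ∀ v, G.deg v ≤ b) (ord : Enumeration) (s : State Mark Box)
    (hs : Isomorphic s.store.toGraph G) :
    ∃ s', Exec ord normalizeProg s s' ∧ s'.time ≤ s.time + (21 * b + 60) * G.order ∧
      IsNormalFormOf treeRules s'.store.toGraph G := by
  have hder : Derives treeRules G s.store.toGraph := ⟨0, hs.symm⟩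
  obtain ⟨r, hr⟩ : ∃ r, s.store.HasRoot r := by
    obtain ⟨x, hx⟩ := DerivesIn.exists_wellRooted (n := 0) (H := s.store.toGraph) hs.symm hG
    exact ⟨_, Store.exists_hasRoot hx⟩
  have hpos : 1 ≤ G.order := by
    have := G.finV
    obtain ⟨v, -⟩ := hG.2.1
    have : Nonempty G.V := ⟨v⟩
    exact Nat.card_pos
  have hcard : ∀ v, (s.store.outSet v).card ≤ b := by
    obtain ⟨fV, fE, hsrc, -⟩ := isomorphic_iff.1 hs
    intro v
    by_cases hv : v ∈ s.store.V
    -- The degree bound is used through the outdegree only, carried over along the isomorphism.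
    · refine le_trans ?_ ((Nat.le_add_left _ _).trans (hb (fV ⟨v, hv⟩)))
      have := G.finE
      rw [outdeg, ← Nat.card_eq_finsetCard]
      refine Nat.card_le_card_of_injective (fun e => ⟨fE ⟨e.1, (Store.mem_outSet.1 e.2).1⟩, ?_⟩) ?_
      · exact (hsrc _).symm.trans (congrArg fV (Subtype.ext (Store.mem_outSet.1 e.2).2))
      · intro x y hxy
        have := congrArg Subtype.val (fE.injective (congrArg Subtype.val hxy))
        exact Subtype.ext this
    · rw [Finset.card_eq_zero.2]
      · exact Nat.zero_le _
      · refine Finset.eq_empty_iff_forall_notMem.2 fun e he => ?_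
        obtain ⟨heE, rfl⟩ := Store.mem_outSet.1 he
        exact hv (s.store.src_mem e heE)
  -- The state on entry to the loop. Fetching and popping the root takes `3`, the edge query `card +
  -- 1`, and the query for roots labelled `△`, which returns nothing, `1`.
  let s1 : State Mark Box := { s with
    nreg := update s.nreg 0 r
    nlist := update (update (update s.nlist 0 [r]) 0 []) 1 []
    elist := update s.elist 0 (ord.list (s.time + 3) (s.store.outSet r))
    time := s.time + ((s.store.outSet r).card + 5) }
  have hreg : s1.nreg 0 = r := by simp [s1]
  have hel : s1.elist 0 = ord.list (s.time + 3) (s.store.outSet r) := by simp [s1]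
  have hinv : LoopInv G b s1 := by
    refine ⟨hder, ?_, hcard, fun e he => ?_, fun e he he' => ?_, by simp [s1]⟩
    · rw [hreg]; exact hr
    · rw [hel, ord.mem_iff] at he
      rwa [hreg]
    · rw [hel, ord.mem_iff] at he'
      rw [hreg] at he
      exact absurd he he'
  obtain ⟨s', hs', ht, hnf⟩ := hinv.exec_loop hG ord _ le_rfl
  refine ⟨s', .seq (.op rfl) (.seq (exec_popNode (x := r) (xs := []) ?_) (.seq (.op rfl)
    (.seq (.op rfl) ?_))), ?_, hnf⟩
  · simp only [update_self, hr.nodeSet_box, ord.list_singleton]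
  · have e1 : s.time + 1 + 1 + 1 = s.time + 3 := rfl
    have e2 : 3 + ((s.store.outSet r).card + 2) = (s.store.outSet r).card + 5 := by omega
    simpa [hr.nodeSet_box, hr.nodeSet_tri, ord.list_singleton, ord.list_empty, s1, e1, e2,
      add_assoc] using hs'
  · have h1 := hcard r
    have h2 : potential b s1 = (7 * b + 20) * (2 * G.order) + 6 * (s.store.outSet r).card + 10 := by
      rw [potential, hel, ord.length_list, ← hG.weight_eq, ← weight_congr hs]
    have h3 : s1.time = s.time + ((s.store.outSet r).card + 5) := rfl
    -- With `d ≤ b` outgoing edges of the root and `n ≥ 1` nodes, `(d + 5) + 2 * (7 * b + 20) * n +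
    -- 6 * d + 10` is at most `(21 * b + 55) * n`.
    nlinarith

end RootedGT

theorem mainTheorem3 :
    -- every derivation is short, a normal form exists, and every normal form decides tree-ness
    (∀ G : LGraph Mark Box, IsInputGraph G →
      (∀ n H, DerivesIn treeRules n G H → n ≤ 2 * G.order) ∧
      (∃ H, IsNormalFormOf treeRules H G) ∧
      (∀ H, IsNormalFormOf treeRules H G →
        (LGraph.Isomorphic H singleRoot ↔ (unlabel G).cls ∈ TREE.language) ∧
        (LGraph.Isomorphic H singleRoot ↔ (unlabel G).IsTree))) ∧
    -- one program finds a normal form, in linear time on inputs of degree at most `b`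
    (∃ P : Prog Mark Box, ∀ b : ℕ, ∃ c : ℕ,
      ∀ G : LGraph Mark Box, IsInputGraph G → (∀ v, G.deg v ≤ b) →
      ∀ (ord : Enumeration) (s : State Mark Box), LGraph.Isomorphic s.store.toGraph G →
        ∃ s' : State Mark Box, Exec ord P s s' ∧
          s'.time ≤ s.time + c * G.order ∧
          IsNormalFormOf treeRules s'.store.toGraph G) := by
  refine ⟨fun G hG => ⟨fun n H h => ?_, exists_isNormalFormOf G, fun H h => isNormalFormOf_iff hG h⟩,
    normalizeProg, fun b => ⟨21 * b + 60, fun G hG hb ord s hs => ?_⟩⟩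
  · have := h.add_weight_le
    rw [hG.weight_eq] at this
    omega
  · exact exec_normalizeProg hG hb ord s hs
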